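/- Let $n\ge 0$ and $k\ge1$ be integers. For a $\{0,1,-1\}$-matrix $M$ with $r$ rows, draw, in the unit cell $[j-1,j]\times[r-i,r-i+1]$ of each entry $M_{ij}\ne0$ (rows numbered from top to bottom), the diagonal of slope $M_{ij}$. Let $\mathcal G_n(M)$ be the set of permutations $\pi\in\mathfrak S_n$ obtained by placing $n$ dots on these segments, no two with the same $x$- or $y$-coordinate, labelling them $1,\dots,n$ by increasing $y$-coordinate and reading the labels by increasing $x$-coordinate. Let $\mathcal G_n^{+^k}$ be the grid class of the $k\times1$ matrix of ones (the shuffles of $k$ increasing sequences, each consisting of consecutive letters), and let $M_k$ be the $2k\times2$ matrix whose odd-numbered rows are $(1,0)$ and whose even-numbered rows are $(0,1)$. For $\pi\in\mathfrak S_n$ let $\mathrm{Des}(\pi)=\{i\in[n-1]:\pi(i)>\pi(i+1)\}$, let $\mathrm{cDes}(\pi)$ be $\mathrm{Des}(\pi)\cup\{n\}$ if $n\ge1$ and $\pi(n)>\pi(1)$, and $\mathrm{Des}(\pi)$ otherwise, and let $\mathrm{cdes}(\pi)=|\mathrm{cDes}(\pi)|$. For $A\subseteq\mathfrak S_n$ let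 $$\mathcal Q(A)=\sum_{\pi\in A}F_{n,\mathrm{Des}(\pi)},\qquad F_{n,D}=\sum_{\substack{i_1\le i_2\le\dots\le i_n\\ i_j<i_{j+1}\text{ if }j\in D}}x_{i_1}x_{i_2}\cdots x_{i_n}.$$ The set $A$ is called fine if $\mathcal Q(A)$ is a symmetric function and is Schur-positive, that is, a linear combination of Schur functions with nonnegative (integer) coefficients. Then, with $c$ the $n$-cycle $(1,2,\dots,n)$ (the identity if $n=0$), $$\mathcal G_n(M_k)=\{c^j\sigma: j\ge0,\ \sigma\in\mathcal G_n^{+^k}\}=\{\pi\in\mathfrak S_n:\mathrm{cdes}(\pi^{-1})\le k\},$$ and $\mathcal G_n(M_k)$ is fine, i.e. $\mathcal Q(\mathcal G_n(M_k))$ is symmetric and Schur-positive. -/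

import Mathlib

namespace SchurGrid

/-! ### Descents and cyclic descents

Permutations of `[n]` are `Equiv.Perm (Fin n)`; position `i : Fin n` stands for the position
`i + 1` in `[n]`. -/

/-- The descent set: the positions `i` that have a successor and satisfy `π i > π (i + 1)`. -/
def Des {n : ℕ} (π : Equiv.Perm (Fin n)) : Finset (Fin n) :=
  Finset.univ.filter fun i => ∃ h : i.val + 1 < n, π ⟨i.val + 1, h⟩ < π i

/-- The cyclic descent set: the descent set, together with the last position if the last entry
is larger than the first one. -/
def cDes {n : ℕ} (π : Equiv.Perm (Fin n)) : Finset (Fin n) :=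
  Des π ∪ Finset.univ.filter fun i => i.val + 1 = n ∧ π ⟨0, i.pos⟩ < π i

/-- The cyclic descent number. -/
def cdes {n : ℕ} (π : Equiv.Perm (Fin n)) : ℕ := (cDes π).card

/-! ### Geometric grid classes -/

/-- The union of line segments drawn for a matrix with entries in `{0, 1, -1}`. Rows are numbered
from top to bottom, so the cell of the entry in row `i` and column `j` of a matrix with `r` rows is
`[j, j + 1] × [r - 1 - i, r - i]`. An entry `1` (resp. `-1`) contributes the diagonal of slope `1`
(resp. `-1`) of its cell. -/
def gridFigure {r s : ℕ} (M : Matrix (Fin r) (Fin s) SignType) : Set (ℝ × ℝ) :=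
  {p | ∃ (i : Fin r) (j : Fin s), ∃ t ∈ Set.Icc (0 : ℝ) 1, p.1 = (j.val : ℝ) + t ∧
    ((M i j = 1 ∧ p.2 = (r : ℝ) - 1 - (i.val : ℝ) + t) ∨
      (M i j = -1 ∧ p.2 = (r : ℝ) - (i.val : ℝ) - t))}

/-- `gridClass M n` is the set of permutations obtained by placing `n` dots on the figure of `M`,
no two with the same abscissa or ordinate, labelling the dots by increasing ordinate and reading
the labels by increasing abscissa: `p i` is the `i`-th dot from the left, and `π i` its label. -/
def gridClass {r s : ℕ} (M : Matrix (Fin r) (Fin s) SignType) (n : ℕ) :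
    Set (Equiv.Perm (Fin n)) :=
  {π | ∃ p : Fin n → ℝ × ℝ, (∀ i, p i ∈ gridFigure M) ∧
    (∀ i j, i < j → (p i).1 < (p j).1) ∧ ∀ i j, π i < π j ↔ (p i).2 < (p j).2}

/-- The `k × 1` matrix of ones; its grid class consists of the shuffles of `k` increasing
sequences, each on a set of consecutive letters. -/
def onesColumn (k : ℕ) : Matrix (Fin k) (Fin 1) SignType := fun _ _ => 1

/-- The `2k × 2` matrix whose rows, from top to bottom, are `(1,0), (0,1), (1,0), (0,1), …`. -/
def rotMatrix (k : ℕ) : Matrix (Fin (2 * k)) (Fin 2) SignType :=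
  fun i j => if i.val % 2 = j.val then 1 else 0

/-- The set (without multiplicities) of all vertical rotations `c ^ j * σ` of elements `σ` of `A`,
where `c` is the `n`-cycle `(1, 2, …, n)`. -/
def verticalRotations {n : ℕ} (A : Set (Equiv.Perm (Fin n))) : Set (Equiv.Perm (Fin n)) :=
  {π | ∃ j : ℕ, ∃ σ ∈ A, π = finRotate n ^ j * σ}

/-! ### Symmetric and quasisymmetric functions

Formal power series in the variables `x 0, x 1, x 2, …` with integer coefficients. -/

/-- Gessel's fundamental quasisymmetric function: the sum of `x_{a_1} ⋯ x_{a_n}` over all weakly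
increasing sequences `a` which increase strictly at the positions in `D`. (The last position has no
successor; whether it belongs to `D` is irrelevant.) -/
noncomputable def fundamental (n : ℕ) (D : Finset (Fin n)) : MvPowerSeries ℕ ℤ :=
  fun m => (Set.ncard {a : Fin n → ℕ | Monotone a ∧
    (∀ j ∈ D, ∀ h : j.val + 1 < n, a j < a ⟨j.val + 1, h⟩) ∧
    ∑ j, Finsupp.single (a j) 1 = m} : ℤ)

/-- The quasisymmetric function `Q(A) = ∑ π ∈ A, F_{n, Des π}` of a set of permutations. -/
noncomputable def Q {n : ℕ} (A : Set (Equiv.Perm (Fin n))) : MvPowerSeries ℕ ℤ :=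
  ∑ π ∈ A.toFinite.toFinset, fundamental n (Des π)

/-- The Schur function `s_μ`: the sum of `x^T` over all semistandard tableaux `T` of shape `μ`. -/
noncomputable def schur (μ : YoungDiagram) : MvPowerSeries ℕ ℤ :=
  fun m => (Set.ncard {T : SemistandardYoungTableau μ |
    ∑ c ∈ μ.cells, Finsupp.single (T c.1 c.2) 1 = m} : ℤ)

/-- A symmetric function: a power series of bounded degree which is invariant under all
permutations of the variables. -/
def IsSymmetric (f : MvPowerSeries ℕ ℤ) : Prop :=
  (∃ d : ℕ, ∀ m : ℕ →₀ ℕ, MvPowerSeries.coeff m f ≠ 0 → m.degree ≤ d) ∧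
    ∀ e : Equiv.Perm ℕ, MvPowerSeries.renameEquiv ℤ e f = f

/-- Schur-positivity: `f` is a (finite) linear combination of Schur functions with nonnegative
coefficients. -/
def IsSchurPositive (f : MvPowerSeries ℕ ℤ) : Prop :=
  ∃ c : YoungDiagram →₀ ℤ, (∀ μ, 0 ≤ c μ) ∧ f = c.sum fun μ a => a • schur μ

/-- A set of permutations is fine if its quasisymmetric function is symmetric and
Schur-positive. -/
def IsFine {n : ℕ} (A : Set (Equiv.Perm (Fin n))) : Prop :=
  IsSymmetric (Q A) ∧ IsSchurPositive (Q A)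

end SchurGrid

/-! ### Row insertion in terms of Gelfand–Tsetlin patterns -/

namespace SchurGrid

/-! The coefficient of a monomial `x^m` in `Q A` is the number of words of content `m` whose sorting
permutation lies in `A` (`coeff_Q`). The inverse of that permutation is the standardization of the
word. For `A = {π | cdes π⁻¹ ≤ k}` this means counting words with at most `k` cyclic descents, the
return from the last letter to the first being counted when the first is at most the last
(`cyclicGaps`).

For each content, this cyclic statistic is equidistributed with a linear one: one plus the number of
descents, the first gap being ignored (`ncard_cyclicGaps_le`). To see this, insert `k` bars in a
word, at least one in every counted gap. The number of ways depends only on `k` and the number of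
counted gaps (`ncard_barSet`), so the totals over all words, for every `k`, determine the
distribution. A barred word is a first letter `x` together with a multiset of pairs (level, letter)
in a window. In both the cyclic and the linear window every letter has exactly `k` levels available,
and a bijection of the windows that preserves letters yields a bijection of barred words
(`ncard_windowSet_eq`). As the linear window does not depend on the letters, renaming letters
preserves the count, which gives symmetry (`ncard_linearGaps_le_mapDomain`).

The linear statistic is a function of the descent set of the word. Under the
Robinson–Schensted–Knuth correspondence descent sets of words become descent sets of recording
tableaux, so the generating function is a sum of Schur functions over recording tableaux
(`isSchurPositive_of_coeff_eq`). Tableaux are handled as Gelfand–Tsetlin patterns, in which row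
insertion is a path recording the row of the new box at each level.

The figure of `rotMatrix k` consists of `k + 1` parallel segments of slope 1, the extreme ones cut
to half length. The segment numbers of the dots, listed by label, form an admissible placement of
bars for `cDes π⁻¹`, and every placement can be realized (`gridClass_rotMatrix_succ`). Vertical
rotation of `π` cyclically shifts `cDes π⁻¹`; moving a cyclic descent to the last position reaches
the grid class of the column (`verticalRotations_onesColumn`). -/

/-- A semistandard tableau with entries `< B`, encoded by the number `Λ i r` of entries `< i` in
row `r`. -/
structure IsGTPattern (B : ℕ) (Λ : ℕ → ℕ → ℕ) : Prop where
  zero : ∀ r, Λ 0 r = 0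
  mono : ∀ i r, Λ i r ≤ Λ (i + 1) r
  interlace : ∀ i r, Λ (i + 1) (r + 1) ≤ Λ i r
  const : ∀ i r, B ≤ i → Λ i r = Λ B r

/-- `Λ'` arises from `Λ` by inserting the letter `x`; at level `i`, the new box is in row `ρ i`. -/
structure Bump (Λ Λ' : ℕ → ℕ → ℕ) (x : ℕ) (ρ : ℕ → ℕ) : Prop where
  add : ∀ i r, Λ' i r = Λ i r + if x < i ∧ r = ρ i then 1 else 0
  low : ∀ i ≤ x + 1, ρ i = 0
  step : ∀ i, x < i → ρ (i + 1) = if Λ (i + 1) (ρ i) = Λ i (ρ i) then ρ i else ρ i + 1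

/-- The rows in which the insertion of `x` adds a box, level by level. -/
def bumpPath (Λ : ℕ → ℕ → ℕ) (x : ℕ) : ℕ → ℕ
  | 0 => 0
  | i + 1 => if i ≤ x then 0 else
      if Λ (i + 1) (bumpPath Λ x i) = Λ i (bumpPath Λ x i) then bumpPath Λ x i
      else bumpPath Λ x i + 1

/-- Row insertion of the letter `x`. -/
def rowInsert (Λ : ℕ → ℕ → ℕ) (x : ℕ) : ℕ → ℕ → ℕ :=
  fun i r => Λ i r + if x < i ∧ r = bumpPath Λ x i then 1 else 0

theorem bump_rowInsert (Λ : ℕ → ℕ → ℕ) (x : ℕ) :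
    Bump Λ (rowInsert Λ x) x (bumpPath Λ x) where
  add _ _ := rfl
  low i hi := by
    cases i with
    | zero => rfl
    | succ i => simp [bumpPath, show i ≤ x by omega]
  step i hi := by
    conv_lhs => rw [bumpPath]
    simp [show ¬ i ≤ x by omega]

namespace Bump

variable {B : ℕ} {Λ Λ' : ℕ → ℕ → ℕ} {x : ℕ} {ρ : ℕ → ℕ}

theorem path_unique {Λ₁ : ℕ → ℕ → ℕ} {ρ₁ : ℕ → ℕ} (h : Bump Λ Λ' x ρ) (h₁ : Bump Λ Λ₁ x ρ₁) :
    ρ = ρ₁ := by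
  funext i
  induction i with
  | zero => rw [h.low 0 (by omega), h₁.low 0 (by omega)]
  | succ i ih =>
    by_cases hi : i ≤ x
    · rw [h.low _ (by omega), h₁.low _ (by omega)]
    · rw [h.step i (by omega), h₁.step i (by omega), ih]

theorem eq_rowInsert (h : Bump Λ Λ' x ρ) : Λ' = rowInsert Λ x ∧ ρ = bumpPath Λ x := by
  have hp := h.path_unique (bump_rowInsert Λ x)
  refine ⟨?_, hp⟩
  funext i r
  rw [h.add, hp, rowInsert]

/-- If the path has just moved down from row `r`, then some letter `i` in that row made it longer
than at the previous level, and interlacing gives the strict inequality. If the path stays, row `r +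
1` does not grow and the inequality persists. -/
theorem addable (h : Bump Λ Λ' x ρ) (hΛ : IsGTPattern B Λ) (i r : ℕ) (hr : ρ i = r + 1) :
    Λ i (r + 1) < Λ i r := by
  induction i generalizing r with
  | zero => have := h.low 0 (by omega); omega
  | succ i ih =>
    by_cases hi : i ≤ x
    · have := h.low (i + 1) (by omega); omega
    · have hs := h.step i (by omega)
      have h1 := hΛ.mono i r
      have h2 := hΛ.interlace i r
      split_ifs at hs with hc
      · have := ih r (by omega)
        rw [← hs, hr] at hc
        omega
      · have hρ : ρ i = r := by omega
        have h3 := hΛ.mono i (ρ i)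
        rw [hρ] at hc h3
        omega

theorem path_lt (h : Bump Λ Λ' x ρ) (i : ℕ) (hi : x < i) : ρ i < i := by
  induction i with
  | zero => omega
  | succ i ih =>
    by_cases hx : i ≤ x
    · rw [h.low _ (by omega)]; omega
    · have hs := h.step i (by omega)
      have := ih (by omega)
      split_ifs at hs <;> omega

theorem isGTPattern (h : Bump Λ Λ' x ρ) (hΛ : IsGTPattern B Λ) (hx : x < B) :
    IsGTPattern B Λ' where
  zero r := by rw [h.add, hΛ.zero]; simp
  mono i r := by
    have h1 := hΛ.mono i r
    rw [h.add, h.add]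
    by_cases hi : x < i ∧ r = ρ i
    · obtain ⟨hi, rfl⟩ := hi
      have hs := h.step i hi
      split_ifs at hs with hc
      · simp [hi, hs, show x < i + 1 by omega, hc]
      · simp only [hi, and_self, if_true]; omega
    · rw [if_neg hi]; omega
  interlace i r := by
    have h1 := hΛ.interlace i r
    rw [h.add, h.add]
    by_cases hi : x < i + 1 ∧ r + 1 = ρ (i + 1)
    · obtain ⟨hi, hr⟩ := hi
      rw [if_pos ⟨hi, hr⟩]
      by_cases hxi : i ≤ x
      · have := h.low (i + 1) (by omega); omega
      · have hs := h.step i (by omega)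
        split_ifs at hs with hc
        · have := h.addable hΛ i r (by omega)
          rw [← hs, ← hr] at hc
          omega
        · rw [if_pos ⟨by omega, by omega⟩]; omega
    · rw [if_neg hi]; omega
  const i r hi := by
    have hρ : ρ i = ρ B := by
      induction i, hi using Nat.le_induction with
      | base => rfl
      | succ i hi ih =>
        rw [h.step i (by omega), hΛ.const (i + 1) _ (by omega), hΛ.const i _ hi, if_pos rfl, ih]
    rw [h.add, h.add, hΛ.const i r hi, hρ]
    simp [hx, show x < i by omega]

/-- Invertibility of bumping: after a move down, the lower row of `Λ'` contains a letter `i`; after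
staying, it contains none. Hence `Λ'` alone determines the path downwards through the levels. -/
theorem step_back (h : Bump Λ Λ' x ρ) (hΛ : IsGTPattern B Λ) (i : ℕ) (hi : x < i) :
    ρ i = if Λ' i (ρ (i + 1)) = Λ' (i + 1) (ρ (i + 1)) then ρ (i + 1) else ρ (i + 1) - 1 := by
  have hs := h.step i hi
  rw [h.add, h.add]
  split_ifs at hs with hc
  · rw [hs]; simp [hi, hc, show x < i + 1 by omega]
  · have := hΛ.mono i (ρ (i + 1))
    rw [hs] at this ⊢
    simp [show x < i + 1 by omega]
    omega

theorem top_lt (h : Bump Λ Λ' x ρ) (hΛ : IsGTPattern B Λ) : Λ' x 0 < Λ' (x + 1) 0 := by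
  have := hΛ.mono x 0
  rw [h.add, h.add, h.low (x + 1) le_rfl]
  simp
  omega

theorem source_unique {Λ₁ : ℕ → ℕ → ℕ} {x₁ : ℕ} {ρ₁ : ℕ → ℕ} (h : Bump Λ Λ' x ρ)
    (hΛ : IsGTPattern B Λ) (hx : x < B) (h₁ : Bump Λ₁ Λ' x₁ ρ₁) (hΛ₁ : IsGTPattern B Λ₁)
    (hx₁ : x₁ < B) (hB : ρ B = ρ₁ B) : x = x₁ ∧ Λ = Λ₁ := by
  have key : ∀ j i, i + j = B → x < i → x₁ < i → ρ i = ρ₁ i := by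
    intro j
    induction j with
    | zero => intro i hi _ _; rw [show i = B by omega, hB]
    | succ j ih =>
      intro i hi h1 h2
      rw [h.step_back hΛ i h1, h₁.step_back hΛ₁ i h2, ih (i + 1) (by omega) (by omega) (by omega)]
  have aux : ∀ {Λ Λ₁ : ℕ → ℕ → ℕ} {x x₁ : ℕ} {ρ ρ₁ : ℕ → ℕ}, Bump Λ Λ' x ρ → IsGTPattern B Λ →
      Bump Λ₁ Λ' x₁ ρ₁ → IsGTPattern B Λ₁ → (∀ i, i ≤ B → x < i → x₁ < i → ρ i = ρ₁ i) → x₁ < B →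
      ¬ x < x₁ := by
    intro Λ Λ₁ x x₁ ρ ρ₁ h hΛ h₁ hΛ₁ hk hB hlt
    -- At level `x₁ + 1` both paths are in row 0, so the path of `x` has met no letter `x₁` there;
    -- but the insertion of `x₁` leaves such a letter in row 0 of `Λ'`.
    have e := hk (x₁ + 1) (by omega) (by omega) (by omega)
    rw [h₁.low _ le_rfl] at e
    have t := h₁.top_lt hΛ₁
    have hs := h.step x₁ hlt
    rw [e] at hs
    split_ifs at hs with hc
    · rw [h.add, h.add, e, ← hs, if_pos ⟨hlt, rfl⟩, if_pos ⟨by omega, rfl⟩] at t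
      rw [← hs] at hc
      omega
  have hxx : x = x₁ := by
    have a1 := aux h hΛ h₁ hΛ₁ (fun i hi => key (B - i) i (by omega)) hx₁
    have a2 := aux h₁ hΛ₁ h hΛ (fun i hi a b => (key (B - i) i (by omega) b a).symm) hx
    omega
  subst hxx
  refine ⟨rfl, ?_⟩
  have hle : ∀ i, i ≤ B → ∀ r, Λ i r = Λ₁ i r := by
    intro i hi r
    have e1 := h.add i r
    have e2 := h₁.add i r
    by_cases hxi : x < i
    · rw [key (B - i) i (by omega) hxi hxi] at e1
      omega
    · simp [hxi] at e1 e2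
      omega
  funext i r
  rcases le_total i B with hi | hi
  · exact hle i hi r
  · rw [hΛ.const i r hi, hΛ₁.const i r hi, hle B le_rfl]

/-- Inserting `x ≤ y` successively, the second box is weakly above the first one. -/
theorem path_le {Λ'' : ℕ → ℕ → ℕ} {y : ℕ} {σ : ℕ → ℕ} (h : Bump Λ Λ' x ρ) (h' : Bump Λ' Λ'' y σ)
    (hxy : x ≤ y) (i : ℕ) : σ i ≤ ρ i := by
  induction i with
  | zero => rw [h'.low 0 (by omega)]; omega
  | succ i ih =>
    by_cases hi : i ≤ y
    · rw [h'.low _ (by omega)]; omega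
    · have s1 := h.step i (by omega)
      have s2 := h'.step i (by omega)
      by_cases hr : σ i = ρ i
      · by_cases hc : Λ (i + 1) (ρ i) = Λ i (ρ i)
        · rw [if_pos hc] at s1
          have a1 := h.add i (ρ i)
          have a2 := h.add (i + 1) (ρ i)
          rw [if_pos ⟨by omega, rfl⟩] at a1
          rw [if_pos ⟨by omega, s1.symm⟩] at a2
          rw [hr, if_pos (by omega)] at s2
          omega
        · rw [if_neg hc] at s1
          split_ifs at s2 <;> omega
      · split_ifs at s1 s2 <;> omega

/-- Inserting `x` and then `y < x`, the second box is strictly below the first one. -/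
theorem path_lt_path {Λ'' : ℕ → ℕ → ℕ} {y : ℕ} {σ : ℕ → ℕ} (h : Bump Λ Λ' x ρ)
    (h' : Bump Λ' Λ'' y σ) (hΛ : IsGTPattern B Λ) (hxy : y < x) (i : ℕ) (hi : x < i) :
    ρ i < σ i := by
  induction i with
  | zero => omega
  | succ i ih =>
    have s2 := h'.step i (by omega)
    by_cases hx : i = x
    · subst hx
      have t := h.top_lt hΛ
      rw [h.low _ le_rfl]
      split_ifs at s2 with hc
      · by_contra h0
        have : σ i = 0 := by omega
        rw [this] at hc
        omega
      · omega
    · have s1 := h.step i (by omega)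
      have := ih (by omega)
      split_ifs at s1 <;> split_ifs at s2 with c2
      · omega
      · omega
      · by_contra h0
        have e : σ i = ρ i + 1 := by omega
        have := hΛ.mono i (ρ i + 1)
        rw [e, h.add, h.add, if_pos ⟨by omega, by omega⟩, if_neg (by omega)] at c2
        omega
      · omega

end Bump

/-- Reverse row insertion: a removable box of a tableau comes from the insertion of a letter. -/
theorem exists_bump {B : ℕ} {Λ' : ℕ → ℕ → ℕ} (hΛ' : IsGTPattern B Λ') (R : ℕ)
    (hR : Λ' B (R + 1) < Λ' B R) :
    ∃ Λ x ρ, x < B ∧ IsGTPattern B Λ ∧ Bump Λ Λ' x ρ ∧ ρ B = R := by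
  -- The path is built from level `i` downwards, starting at a removable box. It keeps its row when
  -- that row has no letter equal to the level below, goes up one row otherwise, and ends when such
  -- a letter is met in row 0; that letter is `x`.
  have key : ∀ i r, Λ' i (r + 1) < Λ' i r → ∃ (x : ℕ) (ρ : ℕ → ℕ), x < i ∧ ρ i = r ∧
      (∀ j ≤ x + 1, ρ j = 0) ∧ Λ' x 0 < Λ' (x + 1) 0 ∧
      (∀ j, x < j → j ≤ i → Λ' j (ρ j + 1) < Λ' j (ρ j)) ∧
      ∀ j, x < j → j < i → (Λ' j (ρ (j + 1)) = Λ' (j + 1) (ρ (j + 1)) ∧ ρ j = ρ (j + 1)) ∨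
        (Λ' j (ρ (j + 1)) < Λ' (j + 1) (ρ (j + 1)) ∧ ρ (j + 1) = ρ j + 1) := by
    intro i
    induction i with
    | zero => intro r h; simp [hΛ'.zero] at h
    | succ i ih =>
      intro r h
      have ext : ∀ r', Λ' i (r' + 1) < Λ' i r' →
          ((Λ' i r = Λ' (i + 1) r ∧ r' = r) ∨ (Λ' i r < Λ' (i + 1) r ∧ r = r' + 1)) →
          ∃ (x : ℕ) (ρ : ℕ → ℕ), x < i + 1 ∧ ρ (i + 1) = r ∧
      (∀ j ≤ x + 1, ρ j = 0) ∧ Λ' x 0 < Λ' (x + 1) 0 ∧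
      (∀ j, x < j → j ≤ i + 1 → Λ' j (ρ j + 1) < Λ' j (ρ j)) ∧
      ∀ j, x < j → j < i + 1 → (Λ' j (ρ (j + 1)) = Λ' (j + 1) (ρ (j + 1)) ∧ ρ j = ρ (j + 1)) ∨
        (Λ' j (ρ (j + 1)) < Λ' (j + 1) (ρ (j + 1)) ∧ ρ (j + 1) = ρ j + 1) := by
        intro r' hr' hrr
        obtain ⟨x, ρ, h1, h2, h3, h4, h5, h6⟩ := ih r' hr'
        refine ⟨x, Function.update ρ (i + 1) r, by omega, by simp, ?_, h4, ?_, ?_⟩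
        · intro j hj
          rw [Function.update_of_ne (by omega), h3 j hj]
        · intro j hj hj'
          rcases Nat.lt_or_ge j (i + 1) with hji | hji
          · rw [Function.update_of_ne (by omega)]; exact h5 j hj (by omega)
          · obtain rfl : j = i + 1 := by omega
            simpa using h
        · intro j hj hj'
          rw [Function.update_of_ne (show j ≠ i + 1 by omega)]
          rcases Nat.lt_or_ge j i with hji | hji
          · rw [Function.update_of_ne (show j + 1 ≠ i + 1 by omega)]; exact h6 j hj hji
          · obtain rfl : j = i := by omega
            simpa [h2] using hrr
      have m0 := hΛ'.mono i r
      have m1 := hΛ'.mono i (r + 1)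
      by_cases hc : Λ' i r = Λ' (i + 1) r
      · exact ext r (by omega) (Or.inl ⟨hc, rfl⟩)
      · cases r with
        | zero =>
          refine ⟨i, fun _ => 0, by omega, rfl, fun _ _ => rfl, by omega, ?_, ?_⟩
          · intro j hj hj'
            obtain rfl : j = i + 1 := by omega
            exact h
          · intro j _ _; omega
        | succ r =>
          have := hΛ'.interlace i r
          exact ext r (by omega) (Or.inr ⟨by omega, rfl⟩)
  obtain ⟨x, ρ₀, h1, h2, h3, h4, h5, h6⟩ := key B R hR
  -- From level `B` on the pattern is constant, so the path has to be constant too.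
  obtain ⟨ρ, hρ⟩ : ∃ ρ : ℕ → ℕ, ρ = fun i => ρ₀ (min i B) := ⟨_, rfl⟩
  have hρ1 : ∀ j, j ≤ B → ρ j = ρ₀ j := fun j hj => by simp [hρ, hj]
  have hρ2 : ∀ j, B ≤ j → ρ j = R := fun j hj => by simp [hρ, hj, h2]
  have g3 : ∀ j ≤ x + 1, ρ j = 0 := fun j hj => by rw [hρ1 j (by omega), h3 j hj]
  have g5 : ∀ j, x < j → Λ' j (ρ j + 1) < Λ' j (ρ j) := by
    intro j hj
    rcases le_total j B with hjB | hjB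
    · rw [hρ1 j hjB]; exact h5 j hj hjB
    · rw [hρ2 j hjB, hΛ'.const j _ hjB, hΛ'.const j _ hjB]; exact hR
  have g6 : ∀ j, x < j → (Λ' j (ρ (j + 1)) = Λ' (j + 1) (ρ (j + 1)) ∧ ρ j = ρ (j + 1)) ∨
        (Λ' j (ρ (j + 1)) < Λ' (j + 1) (ρ (j + 1)) ∧ ρ (j + 1) = ρ j + 1) := by
    intro j hj
    rcases Nat.lt_or_ge j B with hjB | hjB
    · rw [hρ1 j hjB.le, hρ1 (j + 1) (by omega)]; exact h6 j hj hjB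
    · rw [hρ2 j hjB, hρ2 (j + 1) (by omega), hΛ'.const j _ hjB, hΛ'.const (j + 1) _ (by omega)]
      exact Or.inl ⟨rfl, rfl⟩
  have hpos : ∀ i, x < i → 0 < Λ' i (ρ i) := fun i hi => by have := g5 i hi; omega
  obtain ⟨Λ, hΛ⟩ : ∃ Λ : ℕ → ℕ → ℕ, Λ = fun i r => Λ' i r - if x < i ∧ r = ρ i then 1 else 0 :=
    ⟨_, rfl⟩
  have hadd : ∀ i r, Λ' i r = Λ i r + if x < i ∧ r = ρ i then 1 else 0 := by
    intro i r
    rw [hΛ]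
    dsimp only
    split_ifs with hc
    · have := hpos i hc.1; rw [hc.2]; omega
    · simp
  have hGT : IsGTPattern B Λ := by
    refine ⟨fun r => ?_, fun i r => ?_, fun i r => ?_, fun i r hi => ?_⟩
    · have := hΛ'.zero r; have := hadd 0 r; omega
    · have m := hΛ'.mono i r
      rw [hadd, hadd] at m
      by_cases hc : x < i + 1 ∧ r = ρ (i + 1)
      · obtain ⟨hx, rfl⟩ := hc
        rcases Nat.lt_or_ge x i with hxi | hxi
        · rcases g6 i hxi with ⟨_, e⟩ | ⟨e, _⟩
          · simpa [hxi, hx, e] using m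
          · have a1 := hadd i (ρ (i + 1))
            have a2 := hadd (i + 1) (ρ (i + 1))
            rw [if_pos ⟨hx, rfl⟩] at a2
            omega
        · obtain rfl : x = i := by omega
          rw [g3 _ le_rfl] at m ⊢
          rw [hadd, hadd, g3 _ le_rfl] at h4
          simp at h4 m
          omega
      · rw [if_neg hc] at m; omega
    · have m := hΛ'.interlace i r
      have a1 := hadd (i + 1) (r + 1)
      have a2 := hadd i r
      by_cases hc : x < i ∧ r = ρ i
      · obtain ⟨hx, rfl⟩ := hc
        rw [if_pos ⟨hx, rfl⟩] at a2
        rcases g6 i hx with ⟨e, e'⟩ | ⟨e, e'⟩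
        · have := g5 (i + 1) (by omega)
          have a1 := hadd (i + 1) (ρ i)
          have a2 := hadd (i + 1) (ρ i + 1)
          rw [if_pos ⟨by omega, e'⟩] at a1
          rw [← e', if_neg (by omega)] at a2
          have a3 := hadd i (ρ i)
          rw [if_pos ⟨by omega, rfl⟩] at a3
          rw [← e'] at this e
          omega
        · rw [if_pos ⟨by omega, e'.symm⟩] at a1
          omega
      · rw [if_neg hc] at a2; omega
    · have := hΛ'.const i r hi
      rw [hadd, hadd, hρ2 i hi, hρ2 B le_rfl] at this
      simpa [h1, show x < i by omega] using this
  refine ⟨Λ, x, ρ, h1, hGT, ⟨hadd, g3, ?_⟩, by rw [hρ2 B le_rfl]⟩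
  intro i hi
  rcases g6 i hi with ⟨e, e'⟩ | ⟨e, e'⟩
  · rw [← e', hadd, hadd (i + 1) (ρ i), if_pos (by omega), if_pos (by omega)] at e
    rw [if_pos (by omega), e']
  · rw [e', if_neg]
    intro hc
    have m := hΛ'.interlace i (ρ i)
    have h7 := g5 i hi
    have h8 := hadd i (ρ i)
    have h9 := hadd (i + 1) (ρ i)
    rw [if_pos ⟨by omega, rfl⟩] at h8
    rw [if_neg (by omega)] at h9
    have := hΛ'.mono i (ρ i)
    omega

/-! ### The Robinson–Schensted–Knuth correspondence for words -/

/-- The insertion tableau of a word, whose letters are inserted from right to left. -/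
def rsk : List ℕ → ℕ → ℕ → ℕ
  | [] => fun _ _ => 0
  | x :: l => rowInsert (rsk l) x

/-- The recording tableau of a word with letters `< B`, as the list of the rows of the new
boxes. -/
def rskRows (B : ℕ) : List ℕ → List ℕ
  | [] => []
  | x :: l => bumpPath (rsk l) x B :: rskRows B l

/-- Reverse lattice words, which encode standard Young tableaux. -/
def IsLatticeWord : List ℕ → Prop
  | [] => True
  | R :: Rs => IsLatticeWord Rs ∧ ∀ r, (R :: Rs).count (r + 1) ≤ (R :: Rs).count r

/-- The positions of the ascents of a list. -/
def ascSet (l : List ℕ) : Finset ℕ :=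
  (Finset.range (l.length - 1)).filter fun i => l.getD i 0 < l.getD (i + 1) 0

/-- The positions of the descents of a list. -/
def descSet (l : List ℕ) : Finset ℕ :=
  (Finset.range (l.length - 1)).filter fun i => l.getD (i + 1) 0 < l.getD i 0

@[simp] theorem length_rskRows (B : ℕ) (l : List ℕ) : (rskRows B l).length = l.length := by
  induction l with
  | nil => rfl
  | cons x l ih => simp [rskRows, ih]

theorem isGTPattern_rsk {B : ℕ} {l : List ℕ} (hl : ∀ y ∈ l, y < B) : IsGTPattern B (rsk l) := by
  induction l with
  | nil => exact ⟨fun _ => rfl, fun _ _ => le_rfl, fun _ _ => le_rfl, fun _ _ _ => rfl⟩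
  | cons x l ih =>
    exact (bump_rowInsert _ _).isGTPattern (ih fun y hy => hl y (by simp [hy])) (hl x (by simp))

theorem rsk_shape {B : ℕ} {l : List ℕ} (hl : ∀ y ∈ l, y < B) (r : ℕ) :
    rsk l B r = (rskRows B l).count r := by
  induction l with
  | nil => rfl
  | cons x l ih =>
    rw [rsk, rskRows, (bump_rowInsert _ _).add, ih fun y hy => hl y (by simp [hy]),
      List.count_cons]
    simp only [hl x (by simp), true_and, beq_iff_eq, eq_comm (a := r)]

/-- The new box at level `i` is in a row `< i` (`path_lt`), so the first `i` rows contain every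
entry `< i`. These cumulative counts encode the content. -/
theorem sum_rsk {B : ℕ} {l : List ℕ} (hl : ∀ y ∈ l, y < B) (i : ℕ) :
    ∑ r ∈ Finset.range i, rsk l i r = l.countP (· < i) := by
  induction l with
  | nil => simp [rsk]
  | cons x l ih =>
    have h := bump_rowInsert (rsk l) x
    rw [rsk, Finset.sum_congr rfl fun r _ => h.add i r, Finset.sum_add_distrib,
      ih fun y hy => hl y (by simp [hy]), List.countP_cons]
    congr 1
    by_cases hx : x < i
    · have := h.path_lt i hx
      simp [hx, this]
    · simp [hx]

theorem IsGTPattern.shape_antitone {B : ℕ} {Λ : ℕ → ℕ → ℕ} (h : IsGTPattern B Λ) (r : ℕ) :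
    Λ B (r + 1) ≤ Λ B r := by
  rw [← h.const (B + 1) (r + 1) (by omega)]
  exact h.interlace B r

theorem isLatticeWord_rskRows {B : ℕ} {l : List ℕ} (hl : ∀ y ∈ l, y < B) :
    IsLatticeWord (rskRows B l) := by
  induction l with
  | nil => trivial
  | cons x l ih =>
    refine ⟨ih fun y hy => hl y (by simp [hy]), fun r => ?_⟩
    have := (isGTPattern_rsk hl).shape_antitone r
    rwa [rsk_shape hl, rsk_shape hl] at this

/-- Letters are inserted from right to left, so an ascent of the list is an insertion followed by
that of a smaller letter, whose new box is strictly lower (`path_lt_path`); otherwise it is weakly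
higher (`path_le`). -/
theorem ascSet_eq_descSet_rskRows {B : ℕ} {l : List ℕ} (hl : ∀ y ∈ l, y < B) :
    ascSet l = descSet (rskRows B l) := by
  rw [ascSet, descSet, length_rskRows]
  refine Finset.filter_congr fun i hi => ?_
  have hi : i + 1 < l.length := by have := Finset.mem_range.1 hi; omega
  induction l generalizing i with
  | nil => simp at hi
  | cons x l ih =>
    cases i with
    | succ i =>
      simp only [List.getD_cons_succ, rskRows, List.length_cons] at hi ⊢
      exact ih (fun y hy => hl y (by simp [hy])) i (by simp; omega) (by omega)
    | zero =>
      cases l with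
      | nil => simp at hi
      | cons y l =>
        have hG : IsGTPattern B (rsk l) := isGTPattern_rsk fun y hy => hl y (by simp [hy])
        have h := bump_rowInsert (rsk l) y
        have h' := bump_rowInsert (rsk (y :: l)) x
        simp only [List.getD_cons_succ, rskRows, List.getD_cons_zero]
        constructor
        · intro hxy
          exact h.path_lt_path h' hG hxy B (hl y (by simp))
        · intro hlt
          by_contra hxy
          have := h.path_le h' (by omega) B
          omega

theorem rsk_injective {B : ℕ} {l l' : List ℕ} (hl : ∀ y ∈ l, y < B) (hl' : ∀ y ∈ l', y < B)
    (h : rsk l = rsk l') (hR : rskRows B l = rskRows B l') : l = l' := by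
  induction l generalizing l' with
  | nil =>
    have := congrArg List.length hR
    simp only [length_rskRows] at this
    exact (List.eq_nil_of_length_eq_zero this.symm).symm
  | cons x l ih =>
    cases l' with
    | nil => simp [rskRows] at hR
    | cons y l' =>
      simp only [rskRows, List.cons.injEq] at hR
      have b := bump_rowInsert (rsk l) x
      have b' := bump_rowInsert (rsk l') y
      change rowInsert (rsk l) x = rowInsert (rsk l') y at h
      rw [← h] at b'
      have m : ∀ z ∈ l, z < B := fun z hz => hl z (by simp [hz])
      have m' : ∀ z ∈ l', z < B := fun z hz => hl' z (by simp [hz])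
      obtain ⟨e, e'⟩ := b.source_unique (isGTPattern_rsk m) (hl x (by simp)) b'
        (isGTPattern_rsk m') (hl' y (by simp)) hR.1
      rw [e, ih m m' e' hR.2]

/-- The lattice condition makes the last recorded box removable, so reverse insertion can be
iterated. -/
theorem rsk_surjective {B : ℕ} {Rs : List ℕ} (hRs : IsLatticeWord Rs) {Λ : ℕ → ℕ → ℕ}
    (hΛ : IsGTPattern B Λ) (hs : ∀ r, Λ B r = Rs.count r) :
    ∃ l : List ℕ, (∀ y ∈ l, y < B) ∧ rsk l = Λ ∧ rskRows B l = Rs := by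
  induction Rs generalizing Λ with
  | nil =>
    refine ⟨[], by simp, ?_, rfl⟩
    funext i r
    have hm : Monotone fun i => Λ i r := monotone_nat_of_le_succ fun i => hΛ.mono i r
    have h0 : Λ B r = 0 := by simp [hs]
    rcases le_total i B with hi | hi
    · have := hm hi
      simp only [rsk] at this ⊢
      omega
    · rw [hΛ.const i r hi, h0]; rfl
  | cons R Rs ih =>
    have hanti : Rs.count (R + 1) ≤ Rs.count R := by
      cases Rs with
      | nil => simp
      | cons => exact hRs.1.2 R
    obtain ⟨Λ₀, x, ρ, hx, hΛ₀, hb, hρ⟩ := exists_bump hΛ R (by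
      rw [hs, hs]; simp; omega)
    obtain ⟨l, hl, h1, h2⟩ := ih hRs.1 hΛ₀ (by
      intro r
      have := hb.add B r
      rw [hs, List.count_cons, hρ] at this
      simp only [hx, true_and, beq_iff_eq, eq_comm (a := R)] at this
      omega)
    obtain ⟨e1, e2⟩ := hb.eq_rowInsert
    refine ⟨x :: l, by simpa using ⟨hx, hl⟩, ?_, ?_⟩
    · rw [rsk, h1, e1]
    · rw [rskRows, h1, h2, ← e2, hρ]

/-! ### Content, and counting words by their recording tableaux -/

theorem sum_single_eq_iff {ι : Type*} (s : Finset ι) (T : ι → ℕ) (m : ℕ →₀ ℕ) :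
    ∑ c ∈ s, Finsupp.single (T c) 1 = m ↔
      ∀ i, (s.filter fun c => T c < i).card = ∑ j ∈ Finset.range i, m j := by
  have h1 : ∀ j, (∑ c ∈ s, Finsupp.single (T c) 1 : ℕ →₀ ℕ) j =
      (s.filter fun c => T c = j).card := by
    intro j
    rw [Finsupp.finsetSum_apply, Finset.card_filter]
    exact Finset.sum_congr rfl fun c _ => by rw [Finsupp.single_apply]
  have h2 : ∀ i, (s.filter fun c => T c < i).card =
      ∑ j ∈ Finset.range i, (∑ c ∈ s, Finsupp.single (T c) 1 : ℕ →₀ ℕ) j := by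
    intro i
    rw [Finset.card_eq_sum_card_fiberwise (f := T) (t := Finset.range i)]
    · refine Finset.sum_congr rfl fun j hj => ?_
      rw [h1, Finset.filter_filter]
      congr 1
      refine Finset.filter_congr fun c _ => ?_
      have := Finset.mem_range.1 hj
      constructor
      · exact fun h => h.2
      · intro h; omega
    · intro c hc
      simpa using (Finset.mem_filter.1 (Finset.mem_coe.1 hc)).2
  constructor
  · rintro rfl; exact h2
  · intro h
    ext j
    have a := h (j + 1)
    have b := h j
    rw [h2, Finset.sum_range_succ, Finset.sum_range_succ] at a
    rw [h2] at b
    omega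

theorem lt_of_mem_of_sum_single_eq {ι : Type*} {s : Finset ι} {T : ι → ℕ} {m : ℕ →₀ ℕ}
    (h : ∑ c ∈ s, Finsupp.single (T c) 1 = m) {B : ℕ} (hB : ∀ j, B ≤ j → m j = 0) {c : ι}
    (hc : c ∈ s) : T c < B := by
  by_contra hi
  have h0 := hB (T c) (by omega)
  rw [← h, Finsupp.finsetSum_apply, Finset.sum_eq_zero_iff] at h0
  simpa using h0 c hc

theorem lt_of_sum_single_eq {n : ℕ} {w : Fin n → ℕ} {m : ℕ →₀ ℕ}
    (h : ∑ i, Finsupp.single (w i) 1 = m) {B : ℕ} (hB : ∀ j, B ≤ j → m j = 0) (i : Fin n) :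
    w i < B :=
  lt_of_mem_of_sum_single_eq h hB (Finset.mem_univ i)

theorem exists_support_bound (m : ℕ →₀ ℕ) : ∃ B, ∀ j, B ≤ j → m j = 0 := by
  refine ⟨m.support.sup id + 1, fun j hj => ?_⟩
  by_contra h
  have := Finset.le_sup (f := id) (Finsupp.mem_support_iff.2 h)
  simp at this
  omega

theorem finite_words (n : ℕ) (m : ℕ →₀ ℕ) :
    {w : Fin n → ℕ | ∑ i, Finsupp.single (w i) 1 = m}.Finite := by
  obtain ⟨B, hB⟩ := exists_support_bound m
  exact (Set.Finite.pi' fun _ => Set.finite_lt_nat B).subset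
    fun w hw i => lt_of_sum_single_eq hw hB i

theorem countP_ofFn {n : ℕ} (v : Fin n → ℕ) (i : ℕ) :
    (List.ofFn v).countP (· < i) = ∑ j, if v j < i then 1 else 0 := by
  induction n with
  | zero => simp
  | succ n ih => rw [List.ofFn_succ, List.countP_cons, Fin.sum_univ_succ, ih, add_comm]; simp

theorem countP_ofFn_rev {n : ℕ} (w : Fin n → ℕ) (i : ℕ) :
    (List.ofFn fun j => w j.rev).countP (· < i) =
      (Finset.univ.filter fun j => w j < i).card := by
  rw [countP_ofFn, Finset.card_filter]
  exact Equiv.sum_comp Fin.revPerm fun j => if w j < i then 1 else 0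

theorem sum_rsk_iff {n B : ℕ} {w : Fin n → ℕ} (hw : ∀ i, w i < B) (m : ℕ →₀ ℕ) :
    ∑ i, Finsupp.single (w i) 1 = m ↔
      ∀ i, ∑ r ∈ Finset.range i, rsk (List.ofFn fun j => w j.rev) i r =
        ∑ j ∈ Finset.range i, m j := by
  rw [sum_single_eq_iff]
  refine forall_congr' fun i => ?_
  rw [sum_rsk (B := B) (by simp [List.mem_ofFn, hw]), countP_ofFn_rev]

/-- The lists of length `n` with entries `< n`. -/
def boundedLists (n : ℕ) : Finset (List ℕ) :=
  (Finset.univ : Finset (Fin n → Fin n)).image fun v => List.ofFn fun i => (v i : ℕ)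

/-- The rows that occur form an initial segment of `ℕ`, which has at most as many elements as the
list. This makes the set of recording tableaux finite. -/
theorem IsLatticeWord.lt_length {Rs : List ℕ} (h : IsLatticeWord Rs) : ∀ r ∈ Rs, r < Rs.length := by
  induction Rs with
  | nil => simp
  | cons R Rs ih =>
    have key : ∀ r, 0 < (R :: Rs).count r → ∀ s ≤ r, 0 < (R :: Rs).count s := by
      intro r
      induction r with
      | zero => intro h s hs; rwa [Nat.le_zero.1 hs]
      | succ r ihr =>
        intro hr s hs
        rcases Nat.lt_or_ge s (r + 1) with h' | h'
        · exact ihr (lt_of_lt_of_le hr (h.2 r)) s (by omega)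
        · rwa [show s = r + 1 by omega]
    intro r hr
    have : Finset.range (r + 1) ⊆ (R :: Rs).toFinset := by
      intro s hs
      rw [List.mem_toFinset, ← List.count_pos_iff]
      exact key r (List.count_pos_iff.2 hr) s (by simpa [Nat.lt_succ_iff] using hs)
    have := Finset.card_le_card this
    rw [Finset.card_range] at this
    exact lt_of_lt_of_le this (List.toFinset_card_le _)

theorem IsLatticeWord.mem_boundedLists {Rs : List ℕ} (h : IsLatticeWord Rs) {n : ℕ}
    (hn : Rs.length = n) : Rs ∈ boundedLists n := by
  subst hn
  refine Finset.mem_image.2 ⟨fun i => ⟨Rs.get i, h.lt_length _ (List.get_mem _ _)⟩,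
    Finset.mem_univ _, ?_⟩
  exact List.ofFn_get Rs

/-- The recording tableaux of the words of length `n` with a prescribed property of the descent
set. -/
noncomputable def latticeWords (n : ℕ) (P : Finset ℕ → Prop) : Finset (List ℕ) :=
  @Finset.filter _ (fun Rs => Rs.length = n ∧ IsLatticeWord Rs ∧ P (descSet Rs))
    (Classical.decPred _) (boundedLists n)

theorem mem_latticeWords {n : ℕ} {P : Finset ℕ → Prop} {Rs : List ℕ} :
    Rs ∈ latticeWords n P ↔ Rs.length = n ∧ IsLatticeWord Rs ∧ P (descSet Rs) := by
  exact (@Finset.mem_filter _ _ (Classical.decPred _) _ _).trans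
    ⟨fun h => h.2, fun h => ⟨h.2.1.mem_boundedLists h.1, h⟩⟩

/-- The words are grouped by recording tableau. Only `P` sees the descent set, and it is constant on
each group; the insertion tableau maps a group bijectively onto the patterns of the recorded shape
and given content. The list is the reversed word, so the word itself is inserted from left to right.
-/
theorem ncard_words_eq_sum {n B : ℕ} (P : Finset ℕ → Prop) {m : ℕ →₀ ℕ}
    (hB : ∀ j, B ≤ j → m j = 0) :
    {w : Fin n → ℕ | ∑ i, Finsupp.single (w i) 1 = m ∧
      P (ascSet (List.ofFn fun j => w j.rev))}.ncard =
    ∑ Rs ∈ latticeWords n P, {Λ | IsGTPattern B Λ ∧ (∀ r, Λ B r = Rs.count r) ∧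
      ∀ i, ∑ r ∈ Finset.range i, Λ i r = ∑ j ∈ Finset.range i, m j}.ncard := by
  classical
  have hfin : {w : Fin n → ℕ | ∑ i, Finsupp.single (w i) 1 = m ∧
      P (ascSet (List.ofFn fun j => w j.rev))}.Finite :=
    (finite_words n m).subset fun w hw => hw.1
  have hlt : ∀ {w : Fin n → ℕ}, (∀ i, w i < B) →
      ∀ y ∈ (List.ofFn fun j => w j.rev), y < B := by
    intro w hw y hy
    obtain ⟨i, rfl⟩ := List.mem_ofFn.1 hy
    exact hw _
  rw [Set.ncard_eq_toFinset_card _ hfin, Finset.card_eq_sum_card_fiberwise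
    (f := fun w => rskRows B (List.ofFn fun j => w j.rev)) (t := latticeWords n P)]
  · refine Finset.sum_congr rfl fun Rs hRs => ?_
    obtain ⟨hlen, hlat, hP⟩ := mem_latticeWords.1 hRs
    rw [← Set.ncard_coe_finset]
    refine Set.BijOn.ncard_eq (f := fun w => rsk (List.ofFn fun j => w j.rev)) ⟨?_, ?_, ?_⟩
    · intro w hw
      simp only [Finset.coe_filter, Set.Finite.mem_toFinset, Set.mem_ofPred_eq] at hw
      have hw' := lt_of_sum_single_eq hw.1.1 hB
      refine ⟨isGTPattern_rsk (hlt hw'), fun r => ?_, ?_⟩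
      · rw [← hw.2]; exact rsk_shape (hlt hw') r
      · exact (sum_rsk_iff hw' m).1 hw.1.1
    · intro w hw w' hw' h
      simp only [Finset.coe_filter, Set.Finite.mem_toFinset, Set.mem_ofPred_eq] at hw hw'
      have := rsk_injective (hlt (lt_of_sum_single_eq hw.1.1 hB))
        (hlt (lt_of_sum_single_eq hw'.1.1 hB)) h (hw.2.trans hw'.2.symm)
      have := List.ofFn_injective this
      funext i
      simpa using congrFun this i.rev
    · intro Λ hΛ
      obtain ⟨l, hl, h1, h2⟩ := rsk_surjective hlat hΛ.1 hΛ.2.1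
      have hn : l.length = n := by rw [← hlen, ← h2, length_rskRows]
      subst hn
      have hw : (List.ofFn fun j : Fin l.length => (fun i : Fin l.length => l.get i.rev) j.rev) =
          l := by
        simp
      refine ⟨fun i => l.get i.rev, ?_, ?_⟩
      · simp only [Finset.coe_filter, Set.Finite.mem_toFinset, Set.mem_ofPred_eq]
        have hlt' : ∀ i : Fin l.length, l.get i.rev < B := fun i => hl _ (List.get_mem _ _)
        refine ⟨⟨(sum_rsk_iff hlt' m).2 ?_, ?_⟩, ?_⟩
        · rw [hw, h1]; exact hΛ.2.2
        · rw [hw, ascSet_eq_descSet_rskRows hl, h2]; exact hP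
        · rw [hw, h2]
      · show rsk _ = _
        rw [hw, h1]
  · intro w hw
    simp only [Set.Finite.coe_toFinset, Set.mem_ofPred_eq] at hw
    have hw' := hlt (lt_of_sum_single_eq hw.1 hB)
    refine mem_latticeWords.2 ⟨by simp, isLatticeWord_rskRows hw', ?_⟩
    rw [← ascSet_eq_descSet_rskRows hw']
    exact hw.2

/-! ### Semistandard tableaux as Gelfand–Tsetlin patterns -/

theorem lt_card_filter_range_iff {p : ℕ → Prop} [DecidablePred p] {n : ℕ}
    (hp : ∀ a b, a ≤ b → b < n → p b → p a) (c : ℕ) :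
    c < ((Finset.range n).filter p).card ↔ c < n ∧ p c := by
  induction n with
  | zero => simp
  | succ n ih =>
    by_cases h : p n
    · rw [Finset.filter_true_of_mem, Finset.card_range]
      · exact ⟨fun hc => ⟨hc, hp c n (by omega) (by omega) h⟩, fun hc => hc.1⟩
      · intro a ha
        have := Finset.mem_range.1 ha
        exact hp a n (by omega) (by omega) h
    · rw [Finset.range_add_one, Finset.filter_insert, if_neg h,
        ih fun a b hab hb => hp a b hab (by omega)]
      constructor
      · exact fun hc => ⟨by omega, hc.2⟩
      · rintro ⟨hc, hpc⟩
        refine ⟨?_, hpc⟩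
        rcases Nat.lt_or_ge c n with h' | h'
        · exact h'
        · exact absurd (by rwa [show c = n by omega] at hpc) h

/-- The Gelfand–Tsetlin pattern of a semistandard tableau. -/
def gtPattern {μ : YoungDiagram} (T : SemistandardYoungTableau μ) (i r : ℕ) : ℕ :=
  ((Finset.range (μ.rowLen r)).filter fun c => T r c < i).card

theorem lt_gtPattern_iff {μ : YoungDiagram} (T : SemistandardYoungTableau μ) (i r c : ℕ) :
    c < gtPattern T i r ↔ (r, c) ∈ μ ∧ T r c < i := by
  rw [gtPattern, lt_card_filter_range_iff, YoungDiagram.mem_iff_lt_rowLen]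
  intro a b hab hb h
  exact (T.row_weak_of_le hab (YoungDiagram.mem_iff_lt_rowLen.2 hb)).trans_lt h

theorem le_entry {μ : YoungDiagram} (T : SemistandardYoungTableau μ) {r c : ℕ}
    (h : (r, c) ∈ μ) : r ≤ T r c := by
  induction r with
  | zero => omega
  | succ r ih =>
    have := ih (μ.up_left_mem (by omega) le_rfl h)
    have := T.col_strict (show r < r + 1 by omega) h
    omega

theorem sum_gtPattern {μ : YoungDiagram} (T : SemistandardYoungTableau μ) (i : ℕ) :
    ∑ r ∈ Finset.range i, gtPattern T i r = (μ.cells.filter fun c => T c.1 c.2 < i).card := by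
  rw [Finset.card_eq_sum_card_fiberwise (f := Prod.fst) (t := Finset.range i)]
  · refine Finset.sum_congr rfl fun r _ => ?_
    rw [gtPattern]
    refine Finset.card_bij (fun c _ => (r, c)) ?_ (fun a _ b _ h => by simpa using h) ?_
    · intro c hc
      simp only [Finset.mem_filter, Finset.mem_range] at hc
      simp [YoungDiagram.mem_iff_lt_rowLen, hc]
    · rintro ⟨r', c⟩ hc
      simp only [Finset.mem_filter, YoungDiagram.mem_cells] at hc
      obtain ⟨⟨h1, h2⟩, rfl⟩ := hc
      exact ⟨c, by simp [h2, YoungDiagram.mem_iff_lt_rowLen.1 h1], rfl⟩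
  · rintro ⟨r, c⟩ hc
    simp only [Finset.coe_filter, YoungDiagram.mem_cells, Set.mem_ofPred_eq] at hc
    have := le_entry T hc.1
    simp
    omega

theorem IsGTPattern.monotone {B : ℕ} {Λ : ℕ → ℕ → ℕ} (h : IsGTPattern B Λ) (r : ℕ) :
    Monotone fun i => Λ i r :=
  monotone_nat_of_le_succ fun i => h.mono i r

theorem IsGTPattern.antitone {B : ℕ} {Λ : ℕ → ℕ → ℕ} (h : IsGTPattern B Λ) (i : ℕ) :
    Antitone (Λ i) :=
  antitone_nat_of_succ_le fun r => (h.mono i (r + 1)).trans (h.interlace i r)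

theorem isGTPattern_gtPattern {μ : YoungDiagram} (T : SemistandardYoungTableau μ) {B : ℕ}
    (hT : ∀ r c, (r, c) ∈ μ → T r c < B) :
    IsGTPattern B (gtPattern T) ∧ ∀ r, gtPattern T B r = μ.rowLen r := by
  have hlen : ∀ i r, B ≤ i → gtPattern T i r = μ.rowLen r := by
    intro i r hi
    rw [gtPattern, Finset.filter_true_of_mem, Finset.card_range]
    intro c hc
    exact (hT r c (YoungDiagram.mem_iff_lt_rowLen.2 (Finset.mem_range.1 hc))).trans_le hi
  refine ⟨⟨fun r => by simp [gtPattern], fun i r => ?_, fun i r => ?_, fun i r hi => ?_⟩,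
    fun r => hlen B r le_rfl⟩
  · refine le_of_forall_lt fun c hc => ?_
    rw [lt_gtPattern_iff] at hc ⊢
    exact ⟨hc.1, by omega⟩
  · refine le_of_forall_lt fun c hc => ?_
    rw [lt_gtPattern_iff] at hc ⊢
    have := T.col_strict (show r < r + 1 by omega) hc.1
    exact ⟨μ.up_left_mem (by omega) le_rfl hc.1, by omega⟩
  · rw [hlen i r hi, hlen B r le_rfl]

/-- The entry of a cell `(r, c)` is the least `i` with `c < Λ (i + 1) r`, that is, the letter at
whose level the cell appears. Interlacing gives strict columns. -/
theorem exists_gtPattern_eq {μ : YoungDiagram} {B : ℕ} {Λ : ℕ → ℕ → ℕ} (h : IsGTPattern B Λ)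
    (hs : ∀ r, Λ B r = μ.rowLen r) : ∃ T : SemistandardYoungTableau μ, gtPattern T = Λ := by
  classical
  have key : ∀ r c i, (r, c) ∈ μ → (sInf {i | c < Λ (i + 1) r} < i ↔ c < Λ i r) := by
    intro r c i hc
    have hne : ∀ j, c < Λ j r → sInf {i | c < Λ (i + 1) r} < j := by
      intro j hj
      cases j with
      | zero => simp [h.zero] at hj
      | succ j => exact Nat.lt_succ_of_le (Nat.sInf_le hj)
    refine ⟨fun hi => ?_, hne i⟩
    have hB : c < Λ B r := by rw [hs]; exact YoungDiagram.mem_iff_lt_rowLen.1 hc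
    have hmem : sInf {i | c < Λ (i + 1) r} ∈ {i | c < Λ (i + 1) r} := by
      refine Nat.sInf_mem ?_
      cases B with
      | zero => simp [h.zero] at hB
      | succ j => exact ⟨j, hB⟩
    exact lt_of_lt_of_le hmem (h.monotone r (by omega))
  refine ⟨⟨fun r c => if (r, c) ∈ μ then sInf {i | c < Λ (i + 1) r} else 0, ?_, ?_, ?_⟩, ?_⟩
  · intro r j1 j2 hj hc
    have hc1 := μ.up_left_mem le_rfl hj.le hc
    rw [if_pos hc, if_pos hc1, ← Nat.lt_succ_iff, key _ _ _ hc1]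
    exact hj.trans ((key r j2 _ hc).1 (Nat.lt_succ_self _))
  · intro i1 i2 j hi hc
    have hc1 := μ.up_left_mem hi.le le_rfl hc
    rw [if_pos hc, if_pos hc1, key _ _ _ hc1]
    have h1 := (key i2 j _ hc).1 (Nat.lt_succ_self _)
    obtain ⟨r, rfl⟩ : ∃ r, i2 = r + 1 := ⟨i2 - 1, by omega⟩
    exact h1.trans_le ((h.interlace _ r).trans (h.antitone _ (by omega)))
  · intro i j hc
    rw [if_neg hc]
  · funext i r
    refine eq_of_forall_lt_iff fun c => ?_
    rw [lt_gtPattern_iff]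
    change (r, c) ∈ μ ∧ (if (r, c) ∈ μ then sInf {i | c < Λ (i + 1) r} else 0) < i ↔ _
    by_cases hc : (r, c) ∈ μ
    · rw [if_pos hc, key _ _ _ hc]; simp [hc]
    · simp only [hc, false_and, false_iff, not_lt]
      rw [YoungDiagram.mem_iff_lt_rowLen, ← hs] at hc
      rcases le_total i B with hi | hi
      · have := h.monotone r hi
        simp only at this
        omega
      · rw [h.const i r hi]; omega

theorem ncard_tableaux {μ : YoungDiagram} {m : ℕ →₀ ℕ} {B : ℕ} (hB : ∀ j, B ≤ j → m j = 0) :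
    {T : SemistandardYoungTableau μ | ∑ c ∈ μ.cells, Finsupp.single (T c.1 c.2) 1 = m}.ncard =
      {Λ | IsGTPattern B Λ ∧ (∀ r, Λ B r = μ.rowLen r) ∧
        ∀ i, ∑ r ∈ Finset.range i, Λ i r = ∑ j ∈ Finset.range i, m j}.ncard := by
  refine Set.BijOn.ncard_eq (f := gtPattern) ⟨?_, ?_, ?_⟩
  · intro T hT
    have h1 := isGTPattern_gtPattern T (B := B) fun r c hc =>
      lt_of_mem_of_sum_single_eq (T := fun c : ℕ × ℕ => T c.1 c.2) hT hB
        ((YoungDiagram.mem_cells (r, c)).2 hc)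
    refine ⟨h1.1, h1.2, fun i => ?_⟩
    rw [sum_gtPattern]
    exact (sum_single_eq_iff _ (fun c : ℕ × ℕ => T c.1 c.2) m).1 hT i
  · intro T _ T' _ h
    ext r c
    by_cases hc : (r, c) ∈ μ
    · refine eq_of_forall_gt_iff fun i => ?_
      have e := congrFun (congrFun h i) r
      have h1 := lt_gtPattern_iff T i r c
      have h2 := lt_gtPattern_iff T' i r c
      rw [e, h2] at h1
      simpa [hc] using h1.symm
    · rw [T.zeros hc, T'.zeros hc]
  · rintro Λ ⟨h1, h2, h3⟩
    obtain ⟨T, rfl⟩ := exists_gtPattern_eq h1 h2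
    refine ⟨T, ?_, rfl⟩
    refine (sum_single_eq_iff _ (fun c : ℕ × ℕ => T c.1 c.2) m).2 fun i => ?_
    rw [← sum_gtPattern, h3]

/-! ### Schur positivity from descent sets of words -/

/-- The Young diagram whose `r`-th row has as many cells as the list has entries `r`. -/
def countDiagram (Rs : List ℕ) (h : ∀ r, Rs.count (r + 1) ≤ Rs.count r) : YoungDiagram where
  cells := (Rs.toFinset ×ˢ Finset.range Rs.length).filter fun c => c.2 < Rs.count c.1
  isLowerSet := by
    rintro ⟨r, c⟩ ⟨r', c'⟩ ⟨h1, h2⟩ hc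
    simp only [Finset.coe_filter, Finset.mem_product, List.mem_toFinset, Finset.mem_range,
      Set.mem_ofPred_eq] at hc h1 h2 ⊢
    have ha : Antitone fun r => Rs.count r := antitone_nat_of_succ_le h
    have : Rs.count r ≤ Rs.count r' := ha h1
    refine ⟨⟨?_, by omega⟩, by omega⟩
    rw [← List.count_pos_iff]
    omega

theorem rowLen_countDiagram (Rs : List ℕ) (h : ∀ r, Rs.count (r + 1) ≤ Rs.count r) (r : ℕ) :
    (countDiagram Rs h).rowLen r = Rs.count r := by
  refine eq_of_forall_lt_iff fun c => ?_
  rw [← YoungDiagram.mem_iff_lt_rowLen, ← YoungDiagram.mem_cells, countDiagram]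
  simp only [Finset.mem_filter, Finset.mem_product, List.mem_toFinset, Finset.mem_range]
  constructor
  · exact fun hc => hc.2
  · intro hc
    have := List.count_le_length (a := r) (l := Rs)
    exact ⟨⟨List.count_pos_iff.1 (by omega), by omega⟩, hc⟩

theorem IsLatticeWord.count_antitone {Rs : List ℕ} (h : IsLatticeWord Rs) (r : ℕ) :
    Rs.count (r + 1) ≤ Rs.count r := by
  cases Rs with
  | nil => simp
  | cons => exact h.2 r

/-- The sum of the monomials of the words with a prescribed property of the descent set is a sum
of Schur functions. -/
theorem isSchurPositive_of_coeff_eq {n : ℕ} {P : Finset ℕ → Prop} {f : MvPowerSeries ℕ ℤ}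
    (hf : ∀ m, MvPowerSeries.coeff m f = ({w : Fin n → ℕ | ∑ i, Finsupp.single (w i) 1 = m ∧
      P (ascSet (List.ofFn fun j => w j.rev))}.ncard : ℤ)) : IsSchurPositive f := by
  classical
  obtain ⟨sh, hsh⟩ : ∃ sh : List ℕ → YoungDiagram, ∀ Rs, IsLatticeWord Rs →
      ∀ r, (sh Rs).rowLen r = Rs.count r := by
    refine ⟨fun Rs => if h : IsLatticeWord Rs then countDiagram Rs h.count_antitone else ⊥, ?_⟩
    intro Rs h r
    simp only [dif_pos h, rowLen_countDiagram]
  refine ⟨∑ Rs ∈ latticeWords n P, Finsupp.single (sh Rs) 1, fun μ => ?_, ?_⟩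
  · rw [Finsupp.finsetSum_apply]
    refine Finset.sum_nonneg fun Rs _ => ?_
    rw [Finsupp.single_apply]
    split_ifs <;> simp
  · rw [← Finsupp.sum_finsetSum_index (by simp) (by intros; rw [add_smul])]
    ext m
    obtain ⟨B, hB⟩ := exists_support_bound m
    rw [hf, ncard_words_eq_sum P hB, map_sum, Nat.cast_sum]
    refine Finset.sum_congr rfl fun Rs hRs => ?_
    rw [Finsupp.sum_single_index (by simp), one_smul]
    change _ = (Set.ncard _ : ℤ)
    rw [ncard_tableaux hB]
    simp only [hsh Rs (mem_latticeWords.1 hRs).2.1]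

/-! ### Words and permutations -/

/-- A weakly increasing `a` is constant between two positions with equal values, so strictness at
descents says that `π` has no descent on such a block, hence increases on it. -/
theorem strict_at_descents_iff {n : ℕ} (π : Equiv.Perm (Fin n)) {a : Fin n → ℕ}
    (ha : Monotone a) :
    (∀ j ∈ Des π, ∀ h : j.val + 1 < n, a j < a ⟨j.val + 1, h⟩) ↔
      ∀ i j, i < j → a i = a j → π i < π j := by
  constructor
  · intro h
    have step : ∀ (i : Fin n) (hi : i.val + 1 < n), a i = a ⟨i.val + 1, hi⟩ →
        π i < π ⟨i.val + 1, hi⟩ := by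
      intro i hi hai
      by_contra hlt
      have hne : π ⟨i.val + 1, hi⟩ ≠ π i := by
        intro e
        have := congrArg Fin.val (π.injective e)
        simp at this
      have := h i (by
        simp only [Des, Finset.mem_filter, Finset.mem_univ, true_and]
        exact ⟨hi, lt_of_le_of_ne (not_lt.1 hlt) hne⟩) hi
      omega
    have key : ∀ d (i : Fin n) (hd : i.val + d + 1 < n), a i = a ⟨i.val + d + 1, hd⟩ →
        π i < π ⟨i.val + d + 1, hd⟩ := by
      intro d
      induction d with
      | zero => exact step
      | succ d ih =>
        intro i hd he
        have h1 : a i ≤ a ⟨i.val + d + 1, by omega⟩ := ha (show i.val ≤ i.val + d + 1 by omega)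
        have h2 : a ⟨i.val + d + 1, by omega⟩ ≤ a ⟨i.val + (d + 1) + 1, hd⟩ :=
          ha (show i.val + d + 1 ≤ i.val + (d + 1) + 1 by omega)
        have h3 := le_antisymm h1 (h2.trans he.ge)
        exact (ih i (by omega) h3).trans (step ⟨i.val + d + 1, by omega⟩ hd (h3.symm.trans he))
    intro i j hij he
    have hij' : i.val < j.val := hij
    have hj : j = ⟨i.val + (j.val - i.val - 1) + 1, by omega⟩ := Fin.ext (by simp; omega)
    rw [hj] at he ⊢
    exact key _ i _ he
  · intro h j hj hj1
    simp only [Des, Finset.mem_filter, Finset.mem_univ, true_and] at hj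
    obtain ⟨_, hj⟩ := hj
    have hlt : j < ⟨j.val + 1, hj1⟩ := by simp [Fin.lt_def]
    refine lt_of_le_of_ne (ha hlt.le) fun e => ?_
    exact absurd (h j _ hlt e) (not_lt.2 hj.le)

theorem sum_single_comp_perm {n : ℕ} (w : Fin n → ℕ) (π : Equiv.Perm (Fin n)) :
    ∑ i, (Finsupp.single (w (π i)) 1 : ℕ →₀ ℕ) = ∑ i, Finsupp.single (w i) 1 :=
  Equiv.sum_comp π fun i => (Finsupp.single (w i) 1 : ℕ →₀ ℕ)

/-- The coefficients of `Q A` count the words whose sorting permutation is in `A`. -/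
theorem coeff_Q {n : ℕ} (A : Set (Equiv.Perm (Fin n))) (m : ℕ →₀ ℕ) :
    MvPowerSeries.coeff m (Q A) = ({w : Fin n → ℕ | ∑ i, Finsupp.single (w i) 1 = m ∧
      Tuple.sort w ∈ A}.ncard : ℤ) := by
  classical
  have hfin : {w : Fin n → ℕ | ∑ i, Finsupp.single (w i) 1 = m ∧ Tuple.sort w ∈ A}.Finite :=
    (finite_words n m).subset fun w hw => hw.1
  rw [Q, map_sum, Set.ncard_eq_toFinset_card _ hfin, Finset.card_eq_sum_card_fiberwise
    (f := fun w => Tuple.sort w) (t := A.toFinite.toFinset), Nat.cast_sum]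
  · refine Finset.sum_congr rfl fun π hπ => ?_
    change (Set.ncard _ : ℤ) = _
    rw [← Set.ncard_coe_finset, Nat.cast_inj]
    symm
    -- Sorting by `π` turns a word into a sequence counted by the fundamental function: stability of
    -- the sort is exactly strictness at the descents of `π`.
    refine Set.BijOn.ncard_eq (f := fun w => w ∘ π) ⟨?_, ?_, ?_⟩
    · intro w hw
      simp only [Finset.coe_filter, Set.Finite.mem_toFinset, Set.mem_ofPred_eq] at hw
      obtain ⟨h1, h2⟩ := Tuple.eq_sort_iff.1 hw.2.symm
      refine ⟨h1, (strict_at_descents_iff π h1).2 h2, ?_⟩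
      rw [← hw.1.1]
      exact sum_single_comp_perm w π
    · intro w _ w' _ h
      exact π.surjective.injective_comp_right h
    · rintro a ⟨h1, h2, h3⟩
      have hs : π = Tuple.sort (a ∘ ⇑π⁻¹) := by
        refine Tuple.eq_sort_iff.2 ⟨by simpa [Function.comp_def] using h1, ?_⟩
        simpa [Function.comp_def] using (strict_at_descents_iff π h1).1 h2
      refine ⟨a ∘ ⇑π⁻¹, ?_, by funext i; simp⟩
      simp only [Finset.coe_filter, Set.Finite.mem_toFinset, Set.mem_ofPred_eq]
      refine ⟨⟨?_, ?_⟩, hs.symm⟩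
      · rw [← h3]; exact sum_single_comp_perm a π⁻¹
      · rw [← hs]; exact (Set.Finite.mem_toFinset _).1 hπ
  · intro w hw
    simp only [Set.Finite.coe_toFinset, Set.mem_ofPred_eq] at hw ⊢
    exact hw.2

/-- This identifies the inverse of the sorting permutation with the standardization: letters are
compared by value, ties by position. -/
theorem sort_inv_lt_iff {n : ℕ} (w : Fin n → ℕ) (i j : Fin n) :
    (Tuple.sort w)⁻¹ i < (Tuple.sort w)⁻¹ j ↔ w i < w j ∨ w i = w j ∧ i < j := by
  obtain ⟨h1, h2⟩ := Tuple.eq_sort_iff.1 (rfl : Tuple.sort w = Tuple.sort w)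
  have key : ∀ i j : Fin n, w i < w j ∨ w i = w j ∧ i < j →
      (Tuple.sort w)⁻¹ i < (Tuple.sort w)⁻¹ j := by
    intro i j h
    by_contra hn
    rw [not_lt] at hn
    have := h1 hn
    simp at this
    rcases h with h | ⟨h, hij⟩
    · omega
    · rcases hn.lt_or_eq with hn | hn
      · have := h2 _ _ hn (by simp [h])
        simp at this
        exact absurd this (not_lt.2 hij.le)
      · have := (Tuple.sort w)⁻¹.injective hn
        exact absurd hij (by rw [this]; exact lt_irrefl _)
  refine ⟨fun h => ?_, key i j⟩
  by_contra hn
  have hne : i ≠ j := by rintro rfl; exact lt_irrefl _ h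
  have : w j < w i ∨ w j = w i ∧ j < i := by
    rcases lt_trichotomy (w i) (w j) with h' | h' | h'
    · exact absurd (Or.inl h') hn
    · refine Or.inr ⟨h'.symm, ?_⟩
      rcases lt_or_gt_of_ne hne with h'' | h''
      · exact absurd (Or.inr ⟨h', h''⟩) hn
      · exact h''
    · exact Or.inl h'
  exact absurd h (not_lt.2 (key j i this).le)

/-! ### Cyclic and linear descents of words -/

/-- The cyclic descents of a word; the last position counts as a descent also in case of
equality. -/
def cyclicGaps {N : ℕ} (w : Fin (N + 1) → ℕ) : Finset (Fin (N + 1)) :=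
  Finset.univ.filter fun i => (∃ j : Fin N, i = j.castSucc ∧ w j.succ < w j.castSucc) ∨
    (i = Fin.last N ∧ w 0 ≤ w i)

/-- The descents of a word without its first letter, together with the last position. -/
def linearGaps {N : ℕ} (w : Fin (N + 1) → ℕ) : Finset (Fin (N + 1)) :=
  Finset.univ.filter fun i => (∃ j : Fin N, i = j.castSucc ∧ 0 < j.val ∧
    w j.succ < w j.castSucc) ∨ i = Fin.last N

theorem castSucc_mem_cyclicGaps {N : ℕ} {w : Fin (N + 1) → ℕ} {j : Fin N} :
    j.castSucc ∈ cyclicGaps w ↔ w j.succ < w j.castSucc := by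
  simp only [cyclicGaps, Finset.mem_filter, Finset.mem_univ, true_and, Fin.castSucc_inj,
    Fin.castSucc_ne_last, false_and, or_false]
  exact ⟨fun ⟨i, h, h'⟩ => h ▸ h', fun h => ⟨j, rfl, h⟩⟩

theorem last_mem_cyclicGaps {N : ℕ} {w : Fin (N + 1) → ℕ} :
    Fin.last N ∈ cyclicGaps w ↔ w 0 ≤ w (Fin.last N) := by
  simp [cyclicGaps, (Fin.castSucc_ne_last _).symm]

theorem castSucc_mem_linearGaps {N : ℕ} {w : Fin (N + 1) → ℕ} {j : Fin N} :
    j.castSucc ∈ linearGaps w ↔ 0 < j.val ∧ w j.succ < w j.castSucc := by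
  simp only [linearGaps, Finset.mem_filter, Finset.mem_univ, true_and, Fin.castSucc_inj,
    Fin.castSucc_ne_last, or_false]
  exact ⟨fun ⟨i, h, h'⟩ => h ▸ h', fun h => ⟨j, rfl, h⟩⟩

theorem last_mem_linearGaps {N : ℕ} {w : Fin (N + 1) → ℕ} : Fin.last N ∈ linearGaps w := by
  simp [linearGaps]

theorem castSucc_mem_Des {N : ℕ} {π : Equiv.Perm (Fin (N + 1))} {j : Fin N} :
    j.castSucc ∈ Des π ↔ π j.succ < π j.castSucc := by
  simp only [Des, Finset.mem_filter, Finset.mem_univ, true_and]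
  exact ⟨fun ⟨_, h⟩ => h, fun h => ⟨by simp, h⟩⟩

theorem last_notMem_Des {N : ℕ} {π : Equiv.Perm (Fin (N + 1))} : Fin.last N ∉ Des π := by
  simp [Des]

theorem castSucc_mem_cDes {N : ℕ} {π : Equiv.Perm (Fin (N + 1))} {j : Fin N} :
    j.castSucc ∈ cDes π ↔ π j.succ < π j.castSucc := by
  rw [cDes, Finset.mem_union, castSucc_mem_Des]
  simp [j.isLt.ne]

theorem last_mem_cDes {N : ℕ} {π : Equiv.Perm (Fin (N + 1))} :
    Fin.last N ∈ cDes π ↔ π 0 < π (Fin.last N) := by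
  rw [cDes, Finset.mem_union]
  simp [last_notMem_Des]

theorem cDes_sort_inv {N : ℕ} (w : Fin (N + 2) → ℕ) :
    cDes (Tuple.sort w)⁻¹ = cyclicGaps w := by
  ext i
  cases i using Fin.lastCases with
  | last =>
    rw [last_mem_cDes, last_mem_cyclicGaps, sort_inv_lt_iff, le_iff_lt_or_eq]
    simp [Fin.last_pos]
  | cast i =>
    rw [castSucc_mem_cDes, castSucc_mem_cyclicGaps, sort_inv_lt_iff]
    simp [Fin.castSucc_lt_succ.le, not_lt]

/-- For a single letter the two sets differ: the last gap is counted for the word but not for the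
permutation. Since `1 ≤ k`, the bound holds for both. -/
theorem cdes_sort_inv_le_iff {N k : ℕ} (hk : 1 ≤ k) (w : Fin (N + 1) → ℕ) :
    cdes (Tuple.sort w)⁻¹ ≤ k ↔ (cyclicGaps w).card ≤ k := by
  cases N with
  | zero =>
    have h1 : ∀ s : Finset (Fin 1), s.card ≤ k := fun s => (Finset.card_le_univ s).trans (by simpa)
    exact iff_of_true (h1 _) (h1 _)
  | succ N => rw [cdes, cDes_sort_inv]

/-! ### Barred words -/

/-- The numbers of bars placed before the letters of a word, when `k` bars are placed altogether
and there is at least one bar in each gap of `S`. -/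
def barSet {N : ℕ} (S : Finset (Fin (N + 1))) (k : ℕ) : Set (Fin (N + 1) → ℕ) :=
  {L | L 0 = 0 ∧ (∀ i : Fin N, (L i.castSucc + if i.castSucc ∈ S then 1 else 0) ≤ L i.succ) ∧
    (L (Fin.last N) + if Fin.last N ∈ S then 1 else 0) ≤ k}

theorem finite_barSet {N : ℕ} (S : Finset (Fin (N + 1))) (k : ℕ) : (barSet S k).Finite := by
  refine (Set.Finite.pi' fun _ => Set.finite_le_nat k).subset fun L hL i => ?_
  have hm : Monotone L := Fin.monotone_iff_le_succ.2 fun i => by have := hL.2.1 i; omega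
  have := hm (Fin.le_last i)
  have := hL.2.2
  change L i ≤ k
  omega

theorem ncard_barSet_empty_zero (N : ℕ) : (barSet (∅ : Finset (Fin (N + 1))) 0).ncard = 1 := by
  rw [Set.ncard_eq_one]
  refine ⟨fun _ => 0, Set.eq_singleton_iff_unique_mem.2 ⟨by simp [barSet], fun L hL => ?_⟩⟩
  have hm : Monotone L := Fin.monotone_iff_le_succ.2 fun i => by have := hL.2.1 i; omega
  funext i
  have := hm (Fin.le_last i)
  have := hL.2.2
  omega

/-- Removing one bar from each compulsory gap leaves an arbitrary placement of the remaining `k -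
S.card` bars. In the proof, `s i` is the number of compulsory gaps before letter `i`. -/
theorem ncard_barSet {N : ℕ} (S : Finset (Fin (N + 1))) (k : ℕ) :
    (barSet S k).ncard =
      if S.card ≤ k then (barSet (∅ : Finset (Fin (N + 1))) (k - S.card)).ncard else 0 := by
  obtain ⟨s, hs⟩ : ∃ s : Fin (N + 1) → ℕ, ∀ i, s i = (S.filter (· < i)).card := ⟨_, fun _ => rfl⟩
  have s0 : s 0 = 0 := by simp [hs]
  have aux : ∀ i : Fin (N + 1), ∀ T : Finset (Fin (N + 1)),
      (∀ j, j ∈ T ↔ j ∈ S ∧ (j < i ∨ j = i)) →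
      T.card = s i + if i ∈ S then 1 else 0 := by
    intro i T hT
    rw [hs]
    split_ifs with h
    · rw [← Finset.card_insert_of_notMem (a := i) (by simp)]
      congr 1
      ext j
      rw [hT, Finset.mem_insert, Finset.mem_filter]
      constructor
      · rintro ⟨a, b | b⟩
        · exact Or.inr ⟨a, b⟩
        · exact Or.inl b
      · rintro (rfl | ⟨a, b⟩)
        · exact ⟨h, Or.inr rfl⟩
        · exact ⟨a, Or.inl b⟩
    · rw [add_zero]
      congr 1
      ext j
      rw [hT, Finset.mem_filter]
      constructor
      · rintro ⟨a, b | b⟩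
        · exact ⟨a, b⟩
        · exact absurd (b ▸ a) h
      · exact fun ⟨a, b⟩ => ⟨a, Or.inl b⟩
  have s1 : ∀ i : Fin N, s i.succ = s i.castSucc + if i.castSucc ∈ S then 1 else 0 := by
    intro i
    rw [hs i.succ, aux i.castSucc]
    intro j
    rw [Finset.mem_filter, ← le_iff_lt_or_eq, Fin.le_castSucc_iff]
  have s2 : S.card = s (Fin.last N) + if Fin.last N ∈ S then 1 else 0 :=
    aux _ _ fun j => by simp [← le_iff_lt_or_eq, Fin.le_last]
  have low : ∀ L ∈ barSet S k, ∀ i, s i ≤ L i := by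
    intro L hL i
    induction i using Fin.induction with
    | zero => omega
    | succ i ih => have := hL.2.1 i; have := s1 i; omega
  split_ifs with hk
  · refine Set.BijOn.ncard_eq (f := fun L i => L i - s i) ⟨?_, ?_, ?_⟩
    · intro L hL
      refine ⟨by simp [hL.1], fun i => ?_, ?_⟩
      · have := hL.2.1 i; have := s1 i; have := low L hL i.castSucc; have := low L hL i.succ
        simp only [Finset.notMem_empty, if_false]
        omega
      · have := hL.2.2; have := low L hL (Fin.last N)
        simp only [Finset.notMem_empty, if_false]
        omega
    · intro L hL L' hL' h
      funext i
      have h1 : L i - s i = L' i - s i := congrFun h i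
      have := low L hL i
      have := low L' hL' i
      omega
    · intro L hL
      refine ⟨fun i => L i + s i, ⟨by simp [hL.1, s0], fun i => ?_, ?_⟩, by simp⟩
      · have h1 := hL.2.1 i
        have := s1 i
        simp at h1 ⊢
        omega
      · have := hL.2.2
        simp at this ⊢
        omega
  · rw [Set.ncard_eq_zero (finite_barSet S k), Set.eq_empty_iff_forall_notMem]
    intro L hL
    have := hL.2.2
    have := low L hL (Fin.last N)
    omega

theorem sum_ite_le_eq_sum_range {ι : Type*} (s : Finset ι) (f : ι → ℕ) (c : ℕ → ℕ) (k : ℕ) :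
    ∑ i ∈ s, (if f i ≤ k then c (k - f i) else 0) =
      ∑ j ∈ Finset.range (k + 1), (s.filter fun i => f i = j).card * c (k - j) := by
  rw [← Finset.sum_filter, ← Finset.sum_fiberwise_of_maps_to (g := f)
    (t := Finset.range (k + 1))]
  · refine Finset.sum_congr rfl fun j hj => ?_
    rw [Finset.filter_filter, ← smul_eq_mul, ← Finset.sum_const]
    have := Finset.mem_range.1 hj
    refine Finset.sum_congr ?_ ?_
    · exact Finset.filter_congr fun i _ => ⟨fun h => h.2, fun h => ⟨by omega, h⟩⟩
    · intro i hi
      rw [(Finset.mem_filter.1 hi).2]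
  · intro i hi
    have := (Finset.mem_filter.1 hi).2
    simp; omega

/-- The sums form a unitriangular linear system, because `c 0 = 1`, in the numbers of elements with
given value; by induction on `k` it has only one solution. -/
theorem card_filter_le_eq_of_sum_eq {ι κ : Type*} {s : Finset ι} {t : Finset κ} {f : ι → ℕ}
    {g : κ → ℕ} {c : ℕ → ℕ} (hc : c 0 = 1)
    (h : ∀ k, ∑ i ∈ s, (if f i ≤ k then c (k - f i) else 0) =
      ∑ i ∈ t, if g i ≤ k then c (k - g i) else 0) (k : ℕ) :
    (s.filter fun i => f i ≤ k).card = (t.filter fun i => g i ≤ k).card := by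
  have eq : ∀ k, (s.filter fun i => f i = k).card = (t.filter fun i => g i = k).card := by
    intro k
    induction k using Nat.strong_induction_on with
    | _ k ih =>
      have := h k
      rw [sum_ite_le_eq_sum_range, sum_ite_le_eq_sum_range, Finset.sum_range_succ,
        Finset.sum_range_succ,
        Finset.sum_congr rfl fun j hj => by rw [ih j (Finset.mem_range.1 hj)]] at this
      simpa [hc] using this
  have e1 := sum_ite_le_eq_sum_range s f (fun _ => 1) k
  have e2 := sum_ite_le_eq_sum_range t g (fun _ => 1) k
  simp only [eq] at e1
  rw [← e2] at e1
  rwa [Finset.card_filter, Finset.card_filter]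

/-! ### Equidistribution of cyclic and linear descents -/

/-- A letter `x` together with a weakly increasing sequence, of prescribed content, of pairs in
the window `W x`. -/
def windowSet (N : ℕ) (W : ℕ → Set (ℕ ×ₗ ℕ)) (m : ℕ →₀ ℕ) : Set (ℕ × (Fin N → ℕ ×ₗ ℕ)) :=
  {p | toLex (0, p.1) ∈ W p.1 ∧ Monotone p.2 ∧ (∀ i, p.2 i ∈ W p.1) ∧
    Finsupp.single p.1 1 + ∑ i, Finsupp.single (ofLex (p.2 i)).2 1 = m}

theorem sort_comp_sort {α β : Type*} [LinearOrder α] [LinearOrder β] {N : ℕ} (q : Fin N → α)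
    (σ : Equiv.Perm (Fin N)) (φ : α → β) :
    (φ ∘ q ∘ σ) ∘ Tuple.sort (φ ∘ q ∘ σ) = (φ ∘ q) ∘ Tuple.sort (φ ∘ q) :=
  Tuple.comp_perm_comp_sort_eq_comp_sort (f := φ ∘ q) (σ := σ)

/-- A weakly increasing sequence is a multiset, so a bijection between the windows acts by applying
it to each pair and sorting again. The permutation `e` allows the letters to be renamed at the same
time. -/
theorem ncard_windowSet_eq {N : ℕ} {W W' : ℕ → Set (ℕ ×ₗ ℕ)} (e : Equiv.Perm ℕ)
    (φ ψ : ℕ → ℕ ×ₗ ℕ → ℕ ×ₗ ℕ)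
    (hφ : ∀ x, ∀ p ∈ W x, φ x p ∈ W' (e x) ∧ ψ x (φ x p) = p ∧
      (ofLex (φ x p)).2 = e (ofLex p).2)
    (hψ : ∀ x, ∀ p ∈ W' (e x), ψ x p ∈ W x ∧ φ x (ψ x p) = p)
    (h0 : ∀ x, toLex (0, x) ∈ W x ↔ toLex (0, e x) ∈ W' (e x)) (m : ℕ →₀ ℕ) :
    (windowSet N W m).ncard = (windowSet N W' (m.mapDomain e)).ncard := by
  have content : ∀ (x : ℕ) (q q' : Fin N → ℕ ×ₗ ℕ) (σ : Equiv.Perm (Fin N)),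
      (∀ i, (ofLex (q' i)).2 = e (ofLex (q (σ i))).2) →
      (Finsupp.single (e x) 1 + ∑ i, Finsupp.single (ofLex (q' i)).2 1 : ℕ →₀ ℕ) =
        (Finsupp.single x 1 + ∑ i, Finsupp.single (ofLex (q i)).2 1 : ℕ →₀ ℕ).mapDomain e := by
    intro x q q' σ h
    rw [Finsupp.mapDomain_add, Finsupp.mapDomain_single, Finsupp.mapDomain_finsetSum,
      ← Equiv.sum_comp σ fun i => (Finsupp.single (ofLex (q i)).2 1 : ℕ →₀ ℕ).mapDomain e]
    simp only [h, Finsupp.mapDomain_single]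
  refine Set.BijOn.ncard_eq
    (f := fun p => (e p.1, (φ p.1 ∘ p.2) ∘ Tuple.sort (φ p.1 ∘ p.2))) ⟨?_, ?_, ?_⟩
  · rintro ⟨x, q⟩ ⟨h1, h2, h3, h4⟩
    refine ⟨(h0 x).1 h1, Tuple.monotone_sort (φ x ∘ q), fun i => (hφ x _ (h3 _)).1, ?_⟩
    simp only at h4 ⊢
    rw [← h4]
    exact content x q _ (Tuple.sort (φ x ∘ q)) fun i => (hφ x _ (h3 _)).2.2
  · rintro ⟨x, q⟩ ⟨h1, h2, h3, h4⟩ ⟨x', q'⟩ ⟨h1', h2', h3', h4'⟩ h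
    simp only [Prod.mk.injEq, EmbeddingLike.apply_eq_iff_eq] at h h2 h2' h3 h3'
    obtain ⟨rfl, h⟩ := h
    have hback : ∀ q : Fin N → ℕ ×ₗ ℕ, Monotone q → (∀ i, q i ∈ W x) →
        (ψ x ∘ (φ x ∘ q) ∘ Tuple.sort (φ x ∘ q)) ∘
          Tuple.sort (ψ x ∘ (φ x ∘ q) ∘ Tuple.sort (φ x ∘ q)) = q := by
      intro q hq hW
      rw [sort_comp_sort, show ψ x ∘ φ x ∘ q = q from funext fun i => (hφ x _ (hW i)).2.1,
        Tuple.sort_eq_refl_iff_monotone.2 hq]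
      rfl
    rw [← hback q h2 h3, h, hback q' h2' h3']
  · rintro ⟨y, q⟩ ⟨h1, h2, h3, h4⟩
    obtain ⟨x, rfl⟩ := e.surjective y
    simp only at h1 h2 h3 h4
    have hback : (φ x ∘ (ψ x ∘ q) ∘ Tuple.sort (ψ x ∘ q)) ∘
          Tuple.sort (φ x ∘ (ψ x ∘ q) ∘ Tuple.sort (ψ x ∘ q)) = q := by
      rw [sort_comp_sort, show φ x ∘ ψ x ∘ q = q from funext fun i => (hψ x _ (h3 i)).2,
        Tuple.sort_eq_refl_iff_monotone.2 h2]
      rfl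
    refine ⟨(x, (ψ x ∘ q) ∘ Tuple.sort (ψ x ∘ q)), ⟨(h0 x).2 h1, Tuple.monotone_sort (ψ x ∘ q),
      fun i => (hψ x _ (h3 _)).1, ?_⟩, ?_⟩
    · refine Finsupp.mapDomain_injective e.injective ?_
      rw [← h4]
      symm
      refine content x _ q (Tuple.sort (ψ x ∘ q))⁻¹ fun i => ?_
      have h5 := (hψ x _ (h3 i))
      have h6 := (hφ x _ h5.1).2.2
      rw [h5.2] at h6
      simpa using h6
    · simp only [hback]

/-- The window of the barred words on a circle. -/
def cyclicWindow (k x : ℕ) : Set (ℕ ×ₗ ℕ) := {p | toLex (0, x) ≤ p ∧ p < toLex (k, x)}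

/-- The window of the barred words on a line. -/
def linearWindow (k : ℕ) (_ : ℕ) : Set (ℕ ×ₗ ℕ) := {p | (ofLex p).1 < k}

/-- A bar in every descent gap means that the pairs (level, letter) increase weakly in lexicographic
order. The condition on the last gap says that the last pair lies strictly before `(k, w 0)`, the
first letter met again after one turn. -/
theorem mem_barSet_cyclicGaps_iff {N k : ℕ} (w L : Fin (N + 1) → ℕ) (hL : L 0 = 0) :
    L ∈ barSet (cyclicGaps w) k ↔ toLex (0, w 0) ∈ cyclicWindow k (w 0) ∧
      Monotone (fun i : Fin N => toLex (L i.succ, w i.succ)) ∧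
      ∀ i : Fin N, toLex (L i.succ, w i.succ) ∈ cyclicWindow k (w 0) := by
  have h1 : L ∈ barSet (cyclicGaps w) k ↔ Monotone (fun i => toLex (L i, w i)) ∧
      toLex (L (Fin.last N), w (Fin.last N)) < toLex (k, w 0) := by
    rw [Fin.monotone_iff_le_succ]
    simp only [barSet, Set.mem_ofPred_eq, hL, true_and, castSucc_mem_cyclicGaps,
      last_mem_cyclicGaps, Prod.Lex.toLex_le_toLex, Prod.Lex.toLex_lt_toLex]
    refine and_congr (forall_congr' fun i => ?_) ?_
    · split_ifs <;> omega
    · split_ifs <;> omega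
  rw [h1]
  simp only [cyclicWindow, Set.mem_ofPred_eq, le_refl, true_and]
  constructor
  · rintro ⟨hm, hl⟩
    have hb : ∀ i, toLex (L i, w i) < toLex (k, w 0) := fun i => (hm (Fin.le_last i)).trans_lt hl
    refine ⟨by simpa [hL] using hb 0, fun i j hij => hm (Fin.succ_le_succ_iff.2 hij),
      fun i => ⟨?_, hb _⟩⟩
    have := hm (Fin.zero_le i.succ)
    simpa [hL] using this
  · rintro ⟨h0, hm, hw⟩
    refine ⟨fun i j hij => ?_, ?_⟩
    · cases i using Fin.cases with
      | zero =>
        cases j using Fin.cases with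
        | zero => exact le_rfl
        | succ j => simpa [hL] using (hw j).1
      | succ i =>
        cases j using Fin.cases with
        | zero => simp at hij
        | succ j => exact hm (Fin.succ_le_succ_iff.1 hij)
    · cases N with
      | zero => simpa [hL] using h0
      | succ N => exact (hw (Fin.last N)).2

/-- The gap after the first letter is never compulsory, so the other pairs are not tied to the first
letter; the compulsory last bar keeps all levels below `k`. -/
theorem mem_barSet_linearGaps_iff {N k : ℕ} (w L : Fin (N + 1) → ℕ) (hL : L 0 = 0) :
    L ∈ barSet (linearGaps w) k ↔ toLex (0, w 0) ∈ linearWindow k (w 0) ∧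
      Monotone (fun i : Fin N => toLex (L i.succ, w i.succ)) ∧
      ∀ i : Fin N, toLex (L i.succ, w i.succ) ∈ linearWindow k (w 0) := by
  simp only [barSet, Set.mem_ofPred_eq, hL, true_and, castSucc_mem_linearGaps,
      last_mem_linearGaps, if_true, linearWindow, ofLex_toLex]
  cases N with
  | zero =>
    simp only [IsEmpty.forall_iff, true_and, Subsingleton.monotone, and_true]
    change L 0 + 1 ≤ k ↔ 0 < k
    omega
  | succ N =>
    rw [Fin.monotone_iff_le_succ, Fin.forall_fin_succ]
    have hz : (Fin.castSucc (0 : Fin (N + 1))) = 0 := rfl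
    have hs : ∀ i : Fin N, (i.succ).castSucc = (i.castSucc).succ := fun i => rfl
    have step : (∀ i : Fin N, (L i.succ.castSucc + if 0 < (i.succ : ℕ) ∧
        w i.succ.succ < w i.succ.castSucc then 1 else 0) ≤ L i.succ.succ) ↔
        ∀ i : Fin N, toLex (L i.castSucc.succ, w i.castSucc.succ) ≤
          toLex (L i.succ.succ, w i.succ.succ) := by
      refine forall_congr' fun i => ?_
      rw [Prod.Lex.toLex_le_toLex, hs]
      simp only [Fin.val_succ, Nat.zero_lt_succ, true_and]
      split_ifs <;> omega
    rw [step, hz, hL]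
    simp only [Fin.val_zero, lt_self_iff_false, false_and, if_false, Nat.zero_le, true_and, add_zero]
    constructor
    · rintro ⟨hm, hl⟩
      have hm' : Monotone fun i : Fin (N + 1) => toLex (L i.succ, w i.succ) :=
        Fin.monotone_iff_le_succ.2 hm
      refine ⟨by omega, hm, fun i => ?_⟩
      have := hm' (Fin.le_last i)
      rw [Prod.Lex.toLex_le_toLex] at this
      rw [Fin.succ_last] at this
      change L i.succ < k
      change L (Fin.last (N + 1)) + 1 ≤ k at hl
      change L i.succ < L (Fin.last (N + 1)) ∨ L i.succ = L (Fin.last (N + 1)) ∧ _ at this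
      omega
    · rintro ⟨_, hm, hw⟩
      exact ⟨hm, hw (Fin.last N)⟩

/-- Summing the numbers of admissible bar placements over all words of given content. -/
theorem sum_ncard_barSet {N k : ℕ} {S : (Fin (N + 1) → ℕ) → Finset (Fin (N + 1))}
    {W : ℕ → Set (ℕ ×ₗ ℕ)} (m : ℕ →₀ ℕ)
    (h : ∀ w L : Fin (N + 1) → ℕ, L 0 = 0 → (L ∈ barSet (S w) k ↔ toLex (0, w 0) ∈ W (w 0) ∧
      Monotone (fun i : Fin N => toLex (L i.succ, w i.succ)) ∧
      ∀ i : Fin N, toLex (L i.succ, w i.succ) ∈ W (w 0))) :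
    ∑ w ∈ (finite_words (N + 1) m).toFinset, (barSet (S w) k).ncard =
      (windowSet N W m).ncard := by
  classical
  have e1 : ∑ w ∈ (finite_words (N + 1) m).toFinset, (barSet (S w) k).ncard =
      ((finite_words (N + 1) m).toFinset.sigma
        fun w => (finite_barSet (S w) k).toFinset).card := by
    rw [Finset.card_sigma]
    exact Finset.sum_congr rfl fun w _ => Set.ncard_eq_toFinset_card _ _
  rw [e1, ← Set.ncard_coe_finset]
  refine Set.BijOn.ncard_eq
    (f := fun p => (p.1 0, fun i : Fin N => toLex (p.2 i.succ, p.1 i.succ))) ⟨?_, ?_, ?_⟩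
  · rintro ⟨w, L⟩ hp
    simp only [Finset.coe_sigma, Set.mem_sigma_iff, Set.Finite.coe_toFinset,
      Set.mem_ofPred_eq] at hp
    obtain ⟨hw, hL⟩ := hp
    obtain ⟨h1, h2, h3⟩ := (h w L hL.1).1 hL
    refine ⟨h1, h2, h3, ?_⟩
    rw [← hw, Fin.sum_univ_succ]
    rfl
  · rintro ⟨w, L⟩ hp ⟨w', L'⟩ hp' he
    simp only [Finset.coe_sigma, Set.mem_sigma_iff, Set.Finite.coe_toFinset,
      Set.mem_ofPred_eq] at hp hp'
    simp only [Prod.mk.injEq] at he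
    have h1 : ∀ i : Fin N, L i.succ = L' i.succ ∧ w i.succ = w' i.succ := fun i => by
      simpa using congrFun he.2 i
    have hw : w = w' := by
      funext i
      cases i using Fin.cases with
      | zero => exact he.1
      | succ i => exact (h1 i).2
    have hL : L = L' := by
      funext i
      cases i using Fin.cases with
      | zero => rw [hp.2.1, hp'.2.1]
      | succ i => exact (h1 i).1
    rw [hw, hL]
  · rintro ⟨x, q⟩ ⟨h1, h2, h3, h4⟩
    simp only at h1 h2 h3 h4
    have hq : (fun i : Fin N => toLex ((Fin.cons 0 (fun i => (ofLex (q i)).1) : Fin (N + 1) → ℕ)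
        i.succ, (Fin.cons x (fun i => (ofLex (q i)).2) : Fin (N + 1) → ℕ) i.succ)) = q := by
      funext i; simp
    refine ⟨⟨Fin.cons x fun i => (ofLex (q i)).2, Fin.cons 0 fun i => (ofLex (q i)).1⟩, ?_, ?_⟩
    · simp only [Finset.coe_sigma, Set.mem_sigma_iff, Set.Finite.coe_toFinset,
        Set.mem_ofPred_eq]
      refine ⟨by rw [← h4, Fin.sum_univ_succ]; rfl, (h _ _ rfl).2 ⟨h1, ?_, fun i => ?_⟩⟩
      · rw [hq]; exact h2
      · exact (congrFun hq i) ▸ h3 i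
    · simp only [hq]; rfl

theorem card_gaps_le_eq {N : ℕ} {S S' : (Fin (N + 1) → ℕ) → Finset (Fin (N + 1))}
    {m m' : ℕ →₀ ℕ}
    (h : ∀ k, ∑ w ∈ (finite_words (N + 1) m).toFinset, (barSet (S w) k).ncard =
      ∑ w ∈ (finite_words (N + 1) m').toFinset, (barSet (S' w) k).ncard) (k : ℕ) :
    {w : Fin (N + 1) → ℕ | ∑ i, Finsupp.single (w i) 1 = m ∧ (S w).card ≤ k}.ncard =
      {w : Fin (N + 1) → ℕ | ∑ i, Finsupp.single (w i) 1 = m' ∧ (S' w).card ≤ k}.ncard := by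
  have conv : ∀ (m : ℕ →₀ ℕ) (S : (Fin (N + 1) → ℕ) → Finset (Fin (N + 1))),
      {w : Fin (N + 1) → ℕ | ∑ i, Finsupp.single (w i) 1 = m ∧ (S w).card ≤ k}.ncard =
        ((finite_words (N + 1) m).toFinset.filter fun w => (S w).card ≤ k).card := by
    intro m S
    rw [← Set.ncard_coe_finset]
    congr 1
    ext w
    simp
  rw [conv, conv]
  refine card_filter_le_eq_of_sum_eq
    (c := fun j => (barSet (∅ : Finset (Fin (N + 1))) j).ncard) (ncard_barSet_empty_zero N)
    (fun k => ?_) k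
  have := h k
  simp only [ncard_barSet (S _), ncard_barSet (S' _)] at this
  exact this

theorem ncard_cyclicGaps_le {N : ℕ} (m : ℕ →₀ ℕ) (k : ℕ) :
    {w : Fin (N + 1) → ℕ | ∑ i, Finsupp.single (w i) 1 = m ∧ (cyclicGaps w).card ≤ k}.ncard =
    {w : Fin (N + 1) → ℕ | ∑ i, Finsupp.single (w i) 1 = m ∧ (linearGaps w).card ≤ k}.ncard := by
  refine card_gaps_le_eq (fun k => ?_) k
  rw [sum_ncard_barSet m (W := cyclicWindow k) fun w L => mem_barSet_cyclicGaps_iff w L,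
    sum_ncard_barSet m (W := linearWindow k) fun w L => mem_barSet_linearGaps_iff w L]
  conv_rhs => rw [← Finsupp.mapDomain_id (v := m)]
  -- In the cyclic window a letter `v ≥ x` has the levels `0, …, k - 1` and a letter `v < x` the
  -- levels `1, …, k`. Replacing level `k` by level `0` gives the linear window.
  refine ncard_windowSet_eq (Equiv.refl ℕ)
    (fun _ p => toLex (if (ofLex p).1 = k then 0 else (ofLex p).1, (ofLex p).2))
    (fun x p => toLex (if (ofLex p).1 = 0 ∧ (ofLex p).2 < x then k else (ofLex p).1,
      (ofLex p).2)) ?_ ?_ ?_ m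
  · intro x p hp
    obtain ⟨⟨L, v⟩, rfl⟩ := toLex.surjective p
    simp only [cyclicWindow, Set.mem_ofPred_eq, Prod.Lex.toLex_le_toLex,
      Prod.Lex.toLex_lt_toLex] at hp
    refine ⟨?_, ?_, rfl⟩
    · change (if L = k then 0 else L) < k
      by_cases hL : L = k
      · rw [if_pos hL]; omega
      · rw [if_neg hL]; omega
    · change toLex (if (if L = k then 0 else L) = 0 ∧ v < x then k else
        (if L = k then 0 else L), v) = toLex (L, v)
      by_cases hL : L = k
      · rw [if_pos hL, if_pos (by omega), hL]
      · rw [if_neg hL, if_neg (by omega)]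
  · intro x p hp
    obtain ⟨⟨L, v⟩, rfl⟩ := toLex.surjective p
    change L < k at hp
    refine ⟨?_, ?_⟩
    · change toLex (0, x) ≤ toLex (if L = 0 ∧ v < x then k else L, v) ∧
        toLex (if L = 0 ∧ v < x then k else L, v) < toLex (k, x)
      rw [Prod.Lex.toLex_le_toLex, Prod.Lex.toLex_lt_toLex]
      by_cases hL : L = 0 ∧ v < x
      · rw [if_pos hL]; omega
      · rw [if_neg hL]; omega
    · change toLex (if (if L = 0 ∧ v < x then k else L) = k then 0 else
        (if L = 0 ∧ v < x then k else L), v) = toLex (L, v)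
      by_cases hL : L = 0 ∧ v < x
      · rw [if_pos hL, if_pos rfl, hL.1]
      · rw [if_neg hL, if_neg (by omega)]
  · intro x
    simp [cyclicWindow, linearWindow, Prod.Lex.toLex_lt_toLex]

/-- The linear window restricts levels only, so any permutation of the letters preserves it. -/
theorem ncard_linearGaps_le_mapDomain {N : ℕ} (m : ℕ →₀ ℕ) (e : Equiv.Perm ℕ) (k : ℕ) :
    {w : Fin (N + 1) → ℕ | ∑ i, Finsupp.single (w i) 1 = m ∧ (linearGaps w).card ≤ k}.ncard =
    {w : Fin (N + 1) → ℕ | ∑ i, Finsupp.single (w i) 1 = m.mapDomain e ∧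
      (linearGaps w).card ≤ k}.ncard := by
  refine card_gaps_le_eq (fun k => ?_) k
  rw [sum_ncard_barSet m (W := linearWindow k) fun w L => mem_barSet_linearGaps_iff w L,
    sum_ncard_barSet _ (W := linearWindow k) fun w L => mem_barSet_linearGaps_iff w L]
  refine ncard_windowSet_eq e
    (fun _ p => toLex ((ofLex p).1, e (ofLex p).2))
    (fun _ p => toLex ((ofLex p).1, e.symm (ofLex p).2)) ?_ ?_ ?_ m
  · intro x p hp
    exact ⟨hp, by simp, rfl⟩
  · intro x p hp
    exact ⟨hp, by simp⟩
  · intro x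
    simp [linearWindow]

theorem card_linearGaps {N : ℕ} (w : Fin (N + 1) → ℕ) :
    (linearGaps w).card =
      ((ascSet (List.ofFn fun j => w j.rev)).filter fun i => i + 1 < N).card + 1 := by
  have hget : ∀ i (hi : i < N + 1), (List.ofFn fun j => w j.rev).getD i 0 =
      w ⟨N - i, by omega⟩ := by
    intro i hi
    rw [List.getD_eq_getElem _ _ (by simpa using hi), List.getElem_ofFn]
    congr 1
    ext
    simp [Fin.val_rev]
  rw [← Finset.card_erase_add_one (last_mem_linearGaps (w := w))]
  congr 1
  -- Reversal sends gap `j` to `N - 1 - j`, so the excluded gap `0` becomes `N - 1`, which `i + 1 <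
  -- N` rules out.
  refine Finset.card_bij' (fun j _ => N - 1 - j.val)
    (fun i _ => ⟨N - 1 - i, by omega⟩) ?_ ?_ ?_ ?_
  · intro j hj
    obtain ⟨h1, h2⟩ := Finset.mem_erase.1 hj
    cases j using Fin.lastCases with
    | last => exact absurd rfl h1
    | cast j =>
      rw [castSucc_mem_linearGaps] at h2
      have hjN := j.isLt
      simp only [ascSet, Finset.mem_filter, Finset.mem_range, List.length_ofFn,
        Fin.val_castSucc]
      refine ⟨⟨by omega, ?_⟩, by omega⟩
      rw [hget _ (by omega), hget _ (by omega)]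
      convert h2.2 using 2 <;> ext <;> simp <;> omega
  · intro i hi
    simp only [ascSet, Finset.mem_filter, Finset.mem_range, List.length_ofFn] at hi
    obtain ⟨⟨h1, h2⟩, h3⟩ := hi
    rw [hget _ (by omega), hget _ (by omega)] at h2
    have e : (⟨N - 1 - i, by omega⟩ : Fin (N + 1)) = (⟨N - 1 - i, by omega⟩ : Fin N).castSucc := rfl
    rw [Finset.mem_erase, e, castSucc_mem_linearGaps]
    refine ⟨Fin.castSucc_ne_last _, by simp; omega, ?_⟩
    convert h2 using 2 <;> ext <;> simp <;> omega
  · intro j hj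
    obtain ⟨h1, h2⟩ := Finset.mem_erase.1 hj
    cases j using Fin.lastCases with
    | last => exact absurd rfl h1
    | cast j =>
      have hjN := j.isLt
      ext
      simp
      omega
  · intro i hi
    simp only [ascSet, Finset.mem_filter, Finset.mem_range, List.length_ofFn] at hi
    simp
    omega

/-! ### Symmetry and fineness -/

theorem isSymmetric_of_coeff {f : MvPowerSeries ℕ ℤ} (d : ℕ)
    (hd : ∀ m, MvPowerSeries.coeff m f ≠ 0 → m.degree ≤ d)
    (h : ∀ (e : Equiv.Perm ℕ) m,
      MvPowerSeries.coeff (m.mapDomain e) f = MvPowerSeries.coeff m f) : IsSymmetric f := by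
  refine ⟨⟨d, hd⟩, fun e => ?_⟩
  ext m
  obtain ⟨m, rfl⟩ : ∃ m', m = Finsupp.embDomain e.toEmbedding m' :=
    ⟨m.mapDomain e.symm, by
      rw [Finsupp.embDomain_eq_mapDomain]
      simp [← Finsupp.mapDomain_comp]⟩
  rw [MvPowerSeries.renameEquiv_apply]
  refine (MvPowerSeries.coeff_embDomain_rename e.toEmbedding f m).trans ?_
  rw [Finsupp.embDomain_eq_mapDomain]
  exact (h e m).symm

theorem degree_of_sum_single_eq {n : ℕ} {w : Fin n → ℕ} {m : ℕ →₀ ℕ}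
    (h : ∑ i, Finsupp.single (w i) 1 = m) : m.degree = n := by
  rw [← h, map_sum]
  simp

theorem isFine_cdes_inv_le (n k : ℕ) (hk : 1 ≤ k) :
    IsFine {π : Equiv.Perm (Fin n) | cdes π⁻¹ ≤ k} := by
  have hdeg : ∀ m, MvPowerSeries.coeff m (Q {π : Equiv.Perm (Fin n) | cdes π⁻¹ ≤ k}) ≠ 0 →
      m.degree ≤ n := by
    intro m hm
    rw [coeff_Q, Nat.cast_ne_zero] at hm
    obtain ⟨w, hw⟩ := Set.nonempty_of_ncard_ne_zero hm
    exact (degree_of_sum_single_eq hw.1).le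
  cases n with
  | zero =>
    have hc : ∀ m, MvPowerSeries.coeff m (Q {π : Equiv.Perm (Fin 0) | cdes π⁻¹ ≤ k}) =
        ({w : Fin 0 → ℕ | ∑ i, Finsupp.single (w i) 1 = m ∧ True}.ncard : ℤ) := by
      intro m
      rw [coeff_Q]
      have : ∀ w : Fin 0 → ℕ, Tuple.sort w ∈ {π : Equiv.Perm (Fin 0) | cdes π⁻¹ ≤ k} := by
        intro w
        simp [cdes, Finset.eq_empty_of_isEmpty]
      simp only [this]
    refine ⟨isSymmetric_of_coeff 0 hdeg fun e m => ?_, isSchurPositive_of_coeff_eq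
      (P := fun _ => True) hc⟩
    rw [hc, hc]
    have : (0 : ℕ →₀ ℕ) = m.mapDomain e ↔ (0 : ℕ →₀ ℕ) = m := by
      rw [← (Finsupp.mapDomain_injective (M := ℕ) e.injective).eq_iff (a := 0) (b := m),
        Finsupp.mapDomain_zero]
    simp only [Finset.univ_eq_empty, Finset.sum_empty, this]
  | succ N =>
    have hc : ∀ m, MvPowerSeries.coeff m (Q {π : Equiv.Perm (Fin (N + 1)) | cdes π⁻¹ ≤ k}) =
        ({w : Fin (N + 1) → ℕ | ∑ i, Finsupp.single (w i) 1 = m ∧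
          (linearGaps w).card ≤ k}.ncard : ℤ) := by
      intro m
      rw [coeff_Q, ← ncard_cyclicGaps_le]
      simp only [Set.mem_ofPred_eq, cdes_sort_inv_le_iff hk]
    refine ⟨isSymmetric_of_coeff (N + 1) hdeg fun e m => ?_, ?_⟩
    · rw [hc, hc, ← ncard_linearGaps_le_mapDomain]
    · refine isSchurPositive_of_coeff_eq (n := N + 1)
        (P := fun s => (s.filter fun i => i + 1 < N).card + 1 ≤ k) fun m => ?_
      simp only [hc, card_linearGaps]

/-! ### Grid classes -/

/-- The left cell of a row and the right cell of the row above it form one segment on the line `y =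
x + 2m - 1`. The line `m = 0` has only its right half, the line `m = k` only its left half. -/
theorem mem_gridFigure_rotMatrix {k : ℕ} (hk : 1 ≤ k) (p : ℝ × ℝ) :
    p ∈ gridFigure (rotMatrix k) ↔ ∃ m : ℕ, m ≤ k ∧ p.2 = p.1 + 2 * m - 1 ∧ 0 ≤ p.1 ∧ p.1 ≤ 2 ∧
      (1 ≤ m ∨ 1 ≤ p.1) ∧ (m < k ∨ p.1 ≤ 1) := by
  have hM : ∀ i j, rotMatrix k i j = 1 ↔ i.val % 2 = j.val := by
    intro i j
    rw [rotMatrix]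
    split_ifs with h <;> simp [h]
  have hM' : ∀ i j, rotMatrix k i j ≠ -1 := by
    intro i j
    rw [rotMatrix]
    split_ifs <;> decide
  constructor
  · rintro ⟨i, j, t, ⟨ht0, ht1⟩, hx, ⟨hij, hy⟩ | ⟨hij, _⟩⟩
    swap
    · exact absurd hij (hM' i j)
    rw [hM] at hij
    have hi := i.isLt
    rw [Nat.cast_mul, Nat.cast_ofNat] at hy
    fin_cases j
    · obtain ⟨a, ha⟩ : ∃ a, i.val = 2 * a := ⟨i.val / 2, by simp at hij; omega⟩
      refine ⟨k - a, by omega, ?_⟩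
      rw [ha] at hy
      rw [Nat.cast_sub (by omega)]
      push_cast at hx hy ⊢
      simp at hx
      exact ⟨by linarith, by linarith, by linarith, Or.inl (by omega), Or.inr (by linarith)⟩
    · obtain ⟨a, ha⟩ : ∃ a, i.val = 2 * a + 1 := ⟨i.val / 2, by simp at hij; omega⟩
      refine ⟨k - (a + 1), by omega, ?_⟩
      rw [ha] at hy
      rw [Nat.cast_sub (by omega)]
      push_cast at hx hy ⊢
      exact ⟨by linarith, by linarith, by linarith, Or.inr (by linarith), Or.inl (by omega)⟩
  · rintro ⟨m, hm, hy, h0, h2, h3, h4⟩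
    by_cases hc : 1 ≤ m ∧ p.1 ≤ 1
    · refine ⟨⟨2 * (k - m), by omega⟩, 0, p.1, ⟨h0, hc.2⟩, by simp, Or.inl ⟨?_, ?_⟩⟩
      · rw [hM]; simp
      · rw [hy]
        push_cast [Nat.cast_sub hm]
        ring
    · have h1 : 1 ≤ p.1 := by
        rcases h3 with h3 | h3
        · rw [not_and] at hc
          exact (not_le.1 (hc h3)).le
        · exact h3
      have hmk : m < k := by
        rcases h4 with h4 | h4
        · exact h4
        · have : ¬ 1 ≤ m := fun h => hc ⟨h, h4⟩
          omega
      refine ⟨⟨2 * (k - (m + 1)) + 1, by omega⟩, 1, p.1 - 1, ⟨by linarith, by linarith⟩, by simp,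
        Or.inl ⟨?_, ?_⟩⟩
      · rw [hM]; simp
      · rw [hy]
        push_cast [Nat.cast_sub (show m + 1 ≤ k from hmk)]
        ring

theorem mem_gridFigure_onesColumn {k : ℕ} (p : ℝ × ℝ) :
    p ∈ gridFigure (onesColumn k) ↔ ∃ m : ℕ, m < k ∧ p.2 = p.1 + m ∧ 0 ≤ p.1 ∧ p.1 ≤ 1 := by
  constructor
  · rintro ⟨i, j, t, ⟨ht0, ht1⟩, hx, ⟨_, hy⟩ | ⟨hij, _⟩⟩
    · have hi := i.isLt
      refine ⟨k - (i + 1), by omega, ?_⟩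
      rw [Nat.cast_sub (by omega)]
      fin_cases j
      push_cast at hx ⊢
      simp at hx
      exact ⟨by linarith, by linarith, by linarith⟩
    · exact absurd hij (by simp [onesColumn])
  · rintro ⟨m, hm, hy, h0, h1⟩
    refine ⟨⟨k - (m + 1), by omega⟩, 0, p.1, ⟨h0, h1⟩, by simp, Or.inl ⟨rfl, ?_⟩⟩
    rw [hy]
    push_cast [Nat.cast_sub (show m + 1 ≤ k from hm)]
    ring

theorem gridClass_zero {r s : ℕ} (M : Matrix (Fin r) (Fin s) SignType) :
    gridClass M 0 = Set.univ :=
  Set.eq_univ_of_forall fun _ =>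
    ⟨fun i => i.elim0, fun i => i.elim0, fun i => i.elim0, fun i => i.elim0⟩

theorem barSet_nonempty_iff {N k : ℕ} {S : Finset (Fin (N + 1))} :
    (barSet S k).Nonempty ↔ S.card ≤ k := by
  rw [← Set.ncard_pos (finite_barSet S k), ncard_barSet]
  split_ifs with h
  · simp only [h, iff_true]
    rw [Set.ncard_pos (finite_barSet _ _)]
    exact ⟨fun _ => 0, by simp [barSet]⟩
  · simp [h]

theorem strictMono_toLex_of_mem_barSet {N k : ℕ} {S : Finset (Fin (N + 1))}
    {τ : Equiv.Perm (Fin (N + 1))} (hS : Des τ ⊆ S) {L : Fin (N + 1) → ℕ} (hL : L ∈ barSet S k) :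
    StrictMono fun v => toLex (L v, τ v) := by
  refine Monotone.strictMono_of_injective (Fin.monotone_iff_le_succ.2 fun i => ?_) ?_
  · rw [Prod.Lex.toLex_le_toLex]
    have h := hL.2.1 i
    by_cases hi : τ i.succ < τ i.castSucc
    · rw [if_pos (hS (castSucc_mem_Des.2 hi))] at h
      exact Or.inl (by dsimp only; omega)
    · rcases Nat.lt_or_ge (L i.castSucc) (L i.succ) with h' | h'
      · exact Or.inl h'
      · exact Or.inr ⟨by dsimp only; omega, not_lt.1 hi⟩
  · intro a b hab
    simp only [Prod.mk.injEq, EmbeddingLike.apply_eq_iff_eq] at hab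
    exact hab.2

/-- A permutation is in a grid class if its dots, listed by increasing labels, are increasing in
the vertical direction. -/
theorem mem_gridClass_iff {r s n : ℕ} {M : Matrix (Fin r) (Fin s) SignType}
    {π : Equiv.Perm (Fin n)} :
    π ∈ gridClass M n ↔ ∃ q : Fin n → ℝ × ℝ, (∀ v, q v ∈ gridFigure M) ∧
      (∀ v v', π⁻¹ v < π⁻¹ v' → (q v).1 < (q v').1) ∧ StrictMono fun v => (q v).2 := by
  constructor
  · rintro ⟨p, h1, h2, h3⟩
    exact ⟨fun v => p (π⁻¹ v), fun v => h1 _, fun v v' => h2 _ _,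
      fun v v' h => (h3 _ _).1 (by simpa using h)⟩
  · rintro ⟨q, h1, h2, h3⟩
    exact ⟨fun i => q (π i), fun i => h1 _, fun i j h => h2 _ _ (by simpa using h),
      fun i j => (h3.lt_iff_lt (a := π i) (b := π j)).symm⟩

/-- With `τ = π⁻¹`, the dot labelled `v` is the `τ v`-th from the left. Line numbers increase weakly
with the label, and strictly at a descent of `τ`, since on one line higher dots are further right.
-/
theorem gridClass_rotMatrix_succ {N k : ℕ} (hk : 1 ≤ k) :
    gridClass (rotMatrix k) (N + 1) = {π | cdes π⁻¹ ≤ k} := by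
  ext π
  rw [mem_gridClass_iff, Set.mem_ofPred_eq, cdes, ← barSet_nonempty_iff]
  generalize π⁻¹ = τ
  constructor
  · rintro ⟨q, h1, h2, h3⟩
    simp only [mem_gridFigure_rotMatrix hk] at h1
    choose m hm using h1
    have mono : ∀ v v', v < v' → (m v ≤ m v' ∧ (τ v' < τ v → m v < m v')) := by
      intro v v' hv
      have hy := h3 hv
      simp only at hy
      obtain ⟨_, a2, a3, a4, _⟩ := hm v
      obtain ⟨_, b2, b3, b4, _⟩ := hm v'
      have hle : m v ≤ m v' := by
        by_contra hlt
        have : (m v' : ℝ) + 1 ≤ m v := by exact_mod_cast (not_le.1 hlt)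
        linarith
      refine ⟨hle, fun hd => lt_of_le_of_ne hle fun he => ?_⟩
      have := h2 _ _ hd
      rw [he] at a2
      linarith
    have hm0 : ∀ v, m 0 ≤ m v := by
      intro v
      rcases (Fin.zero_le v).lt_or_eq with h | h
      · exact (mono _ _ h).1
      · rw [h]
    refine ⟨fun v => m v - m 0, by simp, fun i => ?_, ?_⟩
    · have hi := mono _ _ (Fin.castSucc_lt_succ (i := i))
      have := hm0 i.castSucc
      simp only [castSucc_mem_cDes]
      split_ifs with hd
      · have := hi.2 hd; omega
      · omega
    · simp only [last_mem_cDes]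
      obtain ⟨a1, -, -, -, -, a6⟩ := hm (Fin.last N)
      obtain ⟨-, -, -, -, b5, -⟩ := hm 0
      -- Using both extreme lines would put the first dot at abscissa at least 1 and the last at
      -- most 1, contrary to the cyclic descent.
      split_ifs with hd
      · have hx := h2 _ _ hd
        by_contra hlt
        have e1 : ¬ m (Fin.last N) < k := by omega
        have e2 : ¬ 1 ≤ m 0 := by omega
        have := a6.resolve_left e1
        have := b5.resolve_left e2
        linarith
      · omega
  · rintro ⟨L, hL⟩
    have hmono := strictMono_toLex_of_mem_barSet (τ := τ) Finset.subset_union_left hL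
    have hpos : (0 : ℝ) < N + 1 := by positivity
    have hbound : ∀ v, (τ v : ℝ) < N + 1 := fun v => by exact_mod_cast (τ v).isLt
    obtain ⟨o, c, hoc⟩ : ∃ (o : ℝ) (c : ℕ), ∀ v, L v + c ≤ k ∧ 0 ≤ o + τ v / (N + 1) ∧
        o + τ v / (N + 1) ≤ 2 ∧ (1 ≤ L v + c ∨ 1 ≤ o + τ v / (N + 1)) ∧
        (L v + c < k ∨ o + τ v / (N + 1) ≤ 1) := by
      have hLm : ∀ v v', v ≤ v' → L v < L v' ∨ L v = L v' ∧ τ v ≤ τ v' := fun v v' h => by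
        have := hmono.monotone h
        rwa [Prod.Lex.toLex_le_toLex] at this
      have hl := hL.2.2
      have h01 : ∀ v, (0 : ℝ) ≤ τ v / (N + 1) ∧ (τ v : ℝ) / (N + 1) ≤ 1 := fun v =>
        ⟨by positivity, (div_le_one hpos).2 (hbound v).le⟩
      by_cases hd : τ 0 < τ (Fin.last N)
      · rw [if_pos (last_mem_cDes.2 hd)] at hl
        -- With a cyclic descent at the end, only levels below `k` occur: shifted by one, they fit
        -- in the left halves of the lines `1, …, k`.
        refine ⟨0, 1, fun v => ?_⟩
        have := hLm v _ (Fin.le_last v)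
        have := h01 v
        exact ⟨by omega, by linarith, by linarith, Or.inl (by omega), Or.inr (by linarith)⟩
      · refine ⟨1 - τ 0 / (N + 1), 0, fun v => ?_⟩
        have a1 := hLm v _ (Fin.le_last v)
        have a2 := hLm 0 v (Fin.zero_le v)
        have a3 := h01 v
        have a4 := h01 0
        have div_mono : ∀ a b : Fin (N + 1), a ≤ b → (a : ℝ) / (N + 1) ≤ b / (N + 1) :=
          fun a b h => div_le_div_of_nonneg_right (by exact_mod_cast h) hpos.le
        refine ⟨by omega, by linarith, by linarith, ?_, ?_⟩
        · rcases a2 with a2 | ⟨_, a2⟩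
          · exact Or.inl (by omega)
          · have := div_mono _ _ a2
            exact Or.inr (by linarith)
        · rcases a1 with a1 | ⟨_, a1⟩
          · exact Or.inl (by omega)
          · have := div_mono _ _ (a1.trans (not_lt.1 hd))
            exact Or.inr (by linarith)
    refine ⟨fun v => (o + τ v / (N + 1), o + τ v / (N + 1) + 2 * ((L v + c : ℕ) : ℝ) - 1),
      fun v => ?_, fun v v' h => ?_, fun v v' h => ?_⟩
    · rw [mem_gridFigure_rotMatrix hk]
      obtain ⟨a1, a2, a3, a4, a5⟩ := hoc v
      exact ⟨L v + c, a1, rfl, a2, a3, a4, a5⟩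
    · have : (τ v : ℝ) < τ v' := by exact_mod_cast h
      have := div_lt_div_of_pos_right this hpos
      simpa using this
    · have hlt := hmono h
      rw [Prod.Lex.toLex_lt_toLex] at hlt
      dsimp only at hlt ⊢
      rcases hlt with hlt | ⟨he, hlt⟩
      · have h1 : (τ v : ℝ) / (N + 1) < 1 := (div_lt_one hpos).2 (hbound v)
        have h2 : (0 : ℝ) ≤ τ v' / (N + 1) := by positivity
        have h3 : (L v : ℝ) + 1 ≤ L v' := by exact_mod_cast hlt
        push_cast
        linarith
      · have : (τ v : ℝ) < τ v' := by exact_mod_cast hlt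
        have := div_lt_div_of_pos_right this hpos
        rw [he]
        linarith

/-- The same correspondence between lines and bars as for `rotMatrix`, but with only `k` segments,
so that the last gap is always compulsory. -/
theorem gridClass_onesColumn_succ {N k : ℕ} :
    gridClass (onesColumn k) (N + 1) = {π | (insert (Fin.last N) (Des π⁻¹)).card ≤ k} := by
  ext π
  rw [mem_gridClass_iff, Set.mem_ofPred_eq, ← barSet_nonempty_iff]
  generalize π⁻¹ = τ
  constructor
  · rintro ⟨q, h1, h2, h3⟩
    simp only [mem_gridFigure_onesColumn] at h1
    choose m hm using h1
    have mono : ∀ v v', v < v' → (m v ≤ m v' ∧ (τ v' < τ v → m v < m v')) := by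
      intro v v' hv
      have hy := h3 hv
      simp only at hy
      obtain ⟨_, a2, a3, a4⟩ := hm v
      obtain ⟨_, b2, b3, b4⟩ := hm v'
      have hle : m v ≤ m v' := by
        by_contra hlt
        have : (m v' : ℝ) + 1 ≤ m v := by exact_mod_cast (not_le.1 hlt)
        linarith
      refine ⟨hle, fun hd => lt_of_le_of_ne hle fun he => ?_⟩
      have := h2 _ _ hd
      rw [he] at a2
      linarith
    have hm0 : ∀ v, m 0 ≤ m v := by
      intro v
      rcases (Fin.zero_le v).lt_or_eq with h | h
      · exact (mono _ _ h).1
      · rw [h]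
    refine ⟨fun v => m v - m 0, by simp, fun i => ?_, ?_⟩
    · have hi := mono _ _ (Fin.castSucc_lt_succ (i := i))
      have := hm0 i.castSucc
      simp only [Finset.mem_insert, Fin.castSucc_ne_last, false_or, castSucc_mem_Des]
      split_ifs with hd
      · have := hi.2 hd; omega
      · omega
    · have := (hm (Fin.last N)).1
      simp only [Finset.mem_insert_self, if_true]
      omega
  · rintro ⟨L, hL⟩
    have hmono := strictMono_toLex_of_mem_barSet (τ := τ) (Finset.subset_insert _ _) hL
    have hpos : (0 : ℝ) < N + 1 := by positivity
    have hbound : ∀ v, (τ v : ℝ) < N + 1 := fun v => by exact_mod_cast (τ v).isLt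
    refine ⟨fun v => (τ v / (N + 1), τ v / (N + 1) + (L v : ℝ)),
      fun v => ?_, fun v v' h => ?_, fun v v' h => ?_⟩
    · rw [mem_gridFigure_onesColumn]
      have hl := hL.2.2
      rw [if_pos (Finset.mem_insert_self _ _)] at hl
      have := hmono.monotone (Fin.le_last v)
      rw [Prod.Lex.toLex_le_toLex] at this
      dsimp only at this
      exact ⟨L v, by omega, rfl, by positivity, (div_le_one hpos).2 (hbound v).le⟩
    · have : (τ v : ℝ) < τ v' := by exact_mod_cast h
      exact div_lt_div_of_pos_right this hpos
    · have hlt := hmono h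
      rw [Prod.Lex.toLex_lt_toLex] at hlt
      dsimp only at hlt ⊢
      rcases hlt with hlt | ⟨he, hlt⟩
      · have h1 : (τ v : ℝ) / (N + 1) < 1 := (div_lt_one hpos).2 (hbound v)
        have h2 : (0 : ℝ) ≤ τ v' / (N + 1) := by positivity
        have h3 : (L v : ℝ) + 1 ≤ L v' := by exact_mod_cast hlt
        linarith
      · have : (τ v : ℝ) < τ v' := by exact_mod_cast hlt
        have := div_lt_div_of_pos_right this hpos
        rw [he]
        linarith

/-! ### Rotations -/

theorem mem_cDes_iff {N : ℕ} {τ : Equiv.Perm (Fin (N + 1))} {i : Fin (N + 1)} :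
    i ∈ cDes τ ↔ τ (finRotate (N + 1) i) < τ i := by
  cases i using Fin.lastCases with
  | last => rw [last_mem_cDes, finRotate_last]
  | cast i => rw [castSucc_mem_cDes, finRotate_apply, Fin.coeSucc_eq_succ]

theorem mem_cDes_mul_finRotate_zpow {N : ℕ} {τ : Equiv.Perm (Fin (N + 1))} {j : ℤ}
    {i : Fin (N + 1)} :
    i ∈ cDes (τ * finRotate (N + 1) ^ j) ↔ (finRotate (N + 1) ^ j) i ∈ cDes τ := by
  rw [mem_cDes_iff, mem_cDes_iff, Equiv.Perm.mul_apply, Equiv.Perm.mul_apply,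
    ← Equiv.Perm.mul_apply (finRotate (N + 1)), ← Equiv.Perm.mul_apply (_ ^ j),
    (Commute.refl (finRotate (N + 1))).zpow_right j]

/-- Membership in `cDes` compares the values at cyclically adjacent positions (`mem_cDes_iff`), a
condition that commutes with rotation of the positions. -/
theorem cdes_mul_finRotate_zpow {N : ℕ} (τ : Equiv.Perm (Fin (N + 1))) (j : ℤ) :
    cdes (τ * finRotate (N + 1) ^ j) = cdes τ := by
  refine Finset.card_bij (fun i _ => (finRotate (N + 1) ^ j) i)
    (fun i hi => mem_cDes_mul_finRotate_zpow.1 hi)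
    (fun a _ b _ h => (Equiv.injective _ h)) fun b hb => ?_
  obtain ⟨i, rfl⟩ := (finRotate (N + 1) ^ j).surjective b
  exact ⟨i, mem_cDes_mul_finRotate_zpow.2 hb, rfl⟩

theorem finRotate_pow_apply {N : ℕ} (j : ℕ) (i : Fin (N + 1)) :
    (finRotate (N + 1) ^ j) i = i + Fin.ofNat (N + 1) j := by
  induction j with
  | zero => simp
  | succ j ih =>
    rw [pow_succ', Equiv.Perm.mul_apply, ih, finRotate_apply, add_assoc]
    congr 1
    ext
    simp [Fin.val_add, Fin.ofNat]

theorem cDes_nonempty {N : ℕ} (τ : Equiv.Perm (Fin (N + 2))) : (cDes τ).Nonempty := by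
  refine ⟨τ⁻¹ (Fin.last _), mem_cDes_iff.2 ?_⟩
  have : τ (τ⁻¹ (Fin.last (N + 1))) = Fin.last (N + 1) := by simp
  rw [this]
  refine lt_of_le_of_ne (Fin.le_last _) fun h => ?_
  rw [← this, τ.injective.eq_iff, finRotate_apply] at h
  simp at h

theorem gridClass_rotMatrix (n : ℕ) {k : ℕ} (hk : 1 ≤ k) :
    gridClass (rotMatrix k) n = {π | cdes π⁻¹ ≤ k} := by
  cases n with
  | zero =>
    rw [gridClass_zero, eq_comm, Set.eq_univ_iff_forall]
    intro π
    simp [cdes, Finset.eq_empty_of_isEmpty]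
  | succ N => exact gridClass_rotMatrix_succ hk

theorem cDes_subset_insert_last_Des {N : ℕ} (τ : Equiv.Perm (Fin (N + 1))) :
    cDes τ ⊆ insert (Fin.last N) (Des τ) := by
  intro i hi
  cases i using Fin.lastCases with
  | last => exact Finset.mem_insert_self _ _
  | cast i =>
    rw [castSucc_mem_cDes] at hi
    exact Finset.mem_insert_of_mem (castSucc_mem_Des.2 hi)

/-- A cyclic descent of `π⁻¹` is rotated to the last position, where the always-counted last gap of
the column class is a genuine cyclic descent. For `n = 1` there is none, and `1 ≤ k` suffices. -/
theorem verticalRotations_onesColumn (n : ℕ) {k : ℕ} (hk : 1 ≤ k) :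
    verticalRotations (gridClass (onesColumn k) n) = {π | cdes π⁻¹ ≤ k} := by
  cases n with
  | zero =>
    rw [gridClass_zero]
    ext π
    refine iff_of_true ⟨0, π, trivial, by simp⟩ ?_
    simp [cdes, Finset.eq_empty_of_isEmpty]
  | succ N =>
    rw [gridClass_onesColumn_succ]
    ext π
    constructor
    · rintro ⟨j, σ, hσ, rfl⟩
      rw [Set.mem_ofPred_eq, mul_inv_rev, ← zpow_natCast, ← zpow_neg, cdes_mul_finRotate_zpow]
      exact (Finset.card_le_card (cDes_subset_insert_last_Des _)).trans hσ
    · intro hπ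
      cases N with
      | zero =>
        refine ⟨0, π, ?_, by simp⟩
        exact (Finset.card_le_univ _).trans (by simpa using hk)
      | succ N =>
        obtain ⟨v, hv⟩ := cDes_nonempty π⁻¹
        obtain ⟨j, hj⟩ : ∃ j : ℕ, (finRotate (N + 2) ^ j) (Fin.last (N + 1)) = v := by
          refine ⟨(v - Fin.last (N + 1)).val, ?_⟩
          rw [finRotate_pow_apply, Fin.ofNat_val_eq_self, add_sub_cancel]
        refine ⟨j, (finRotate (N + 2) ^ j)⁻¹ * π, ?_, by simp⟩
        rw [Set.mem_ofPred_eq, mul_inv_rev, inv_inv, ← zpow_natCast]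
        have hsub : insert (Fin.last (N + 1)) (Des (π⁻¹ * finRotate (N + 2) ^ (j : ℤ))) ⊆
            cDes (π⁻¹ * finRotate (N + 2) ^ (j : ℤ)) := by
          refine Finset.insert_subset ?_ Finset.subset_union_left
          rw [mem_cDes_mul_finRotate_zpow, zpow_natCast, hj]
          exact hv
        refine (Finset.card_le_card hsub).trans ?_
        exact (cdes_mul_finRotate_zpow _ _).trans_le hπ

end SchurGrid

theorem corollary6p6 (n k : ℕ) (hk : 1 ≤ k) :
    SchurGrid.gridClass (SchurGrid.rotMatrix k) n =
        SchurGrid.verticalRotations (SchurGrid.gridClass (SchurGrid.onesColumn k) n) ∧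
      SchurGrid.gridClass (SchurGrid.rotMatrix k) n =
        {π : Equiv.Perm (Fin n) | SchurGrid.cdes π⁻¹ ≤ k} ∧
      SchurGrid.IsFine (SchurGrid.gridClass (SchurGrid.rotMatrix k) n) := by
  rw [SchurGrid.verticalRotations_onesColumn n hk, SchurGrid.gridClass_rotMatrix n hk]
  exact ⟨rfl, rfl, SchurGrid.isFine_cdes_inv_le n k hk⟩
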